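/- **Proposition (Derivative of the IC-$L^2$TV solution map).** Let $\Omega\subset\mathbb R^3$ (coordinates $(x,y,t)$) be a bounded connected open set with the interior cone property (for instance a bounded connected Lipschitz domain such as a box): there is one finite circular cone such that every point of $\Omega$ is the vertex of a congruent cone contained in $\Omega$. Let $g\in L^2(\Omega)$ and $\gamma,\epsilon>0$. *Notation.* On $H^1(\Omega)$ let $\nabla=(\partial_x,\partial_y,0)$ and $\frac{\partial}{\partial t}=(0,0,\partial_t)$ (weak derivatives), and $\nabla_\kappa=\kappa\nabla+(1-\kappa)\frac{\partial}{\partial t}=(\kappa\partial_x,\kappa\partial_y,(1-\kappa)\partial_t)$, as operators into $L^2(\Omega;\mathbb R^3)$. Let $\mathrm{div},\ \frac{\partial}{\partial t^*},\ \mathrm{div}_\kappa: L^2(\Omega;\mathbb R^3)\to H^1(\Omega)^*$ be their negative adjoints, e.g. $(\mathrm{div}_\kappa q)(\varphi)=-\int_\Omega q\cdot\nabla_\kappa\varphi\,dx$. Let $I:H^1(\Omega)\to H^1(\Omega)^*$ be the $L^2$-identification $(Iu)(\varphi)=\int_\Omega u\varphi\,dx$, let $c=\chi_\Omega$ and $(c\otimes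 c)w=\big(\int_\Omega w\,dx\big)c$. Let $$H_\gamma(r)=\begin{cases}|r|-\frac\gamma2,&|r|\ge\gamma,\\ \frac1{2\gamma}|r|^2,&|r|<\gamma,\end{cases}\qquad \Theta(v)=\int_\Omega H_\gamma(\|v(x)\|_2)\,dx+\frac\epsilon2\|v\|_2^2\quad(v\in L^2(\Omega;\mathbb R^3)),$$ $\Psi^1_\kappa(u)=[\nabla\Theta](\nabla_\kappa u)$ and $\Psi^2_\kappa(u)=[\nabla^2\Theta](\nabla_\kappa u)$, where $\nabla\Theta$ is the Fréchet gradient in $L^2(\Omega;\mathbb R^3)$ and $\nabla^2\Theta$ the Gâteaux derivative of $\nabla\Theta$. Let $Q(u,w)=(u-w,w)$, let $Q^*$ be its adjoint, from $H^1(\Omega)^*\times H^1(\Omega)^*$ to $(H^1(\Omega)\times H^1(\Omega))^*\cong H^1(\Omega)^*\times H^1(\Omega)^*$, and let $P_1(u,w)=u$. For $u,w\in H^1(\Omega)$ put $$J_{\gamma,\epsilon}(u,w,\alpha_1,\alpha_2,\kappa)=\tfrac12\|u-g\|_2^2+\tfrac{\alpha_1}2\|\nabla_\kappa(u-w)\|_2^2+\alpha_2\Theta(\nabla_{1-\kappa}w)+\tfrac12\Big(\int_\Omega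 w\,dx\Big)^2$$ and $S=\nabla_{(u,w)}J_{\gamma,\epsilon}\in(H^1(\Omega)\times H^1(\Omega))^*$. Call $(\alpha_1,\alpha_2,\kappa)$ admissible if $\alpha_1,\alpha_2>0$ and $\kappa\in\mathbb R\setminus\{0,1\}$. *Claims.* 1. For every admissible $(\alpha_1,\alpha_2,\kappa)$ the functional $J_{\gamma,\epsilon}(\cdot,\cdot,\alpha_1,\alpha_2,\kappa)$ has exactly one minimiser $\hat R_{\gamma,\epsilon}(\alpha_1,\alpha_2,\kappa)$ in $H^1(\Omega)\times H^1(\Omega)$. The functional $\Theta$, and $J_{\gamma,\epsilon}$ as a function of $(u,w)$ for all real parameters, are Fréchet differentiable. 2. Let $(\alpha_1,\alpha_2,\kappa)$ be admissible and let $u,w\in H^1(\Omega)$ satisfy $\|\nabla_{1-\kappa}w(x)\|_2\ne\gamma$ for almost every $x\in\Omega$. Then $\nabla\Theta$ is Gâteaux differentiable at $\nabla_{1-\kappa}w$, $S$ is Gâteaux differentiable in $(u,w)$ and Fréchet differentiable in $(\alpha_1,\alpha_2,\kappa)$ at this point, and $$\frac{\partial S}{\partial(u,w)}=Q^*\begin{pmatrix}I-\alpha_1\mathrm{div}_\kappa\nabla_\kappa&I\\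 I&I-\alpha_2\mathrm{div}_{1-\kappa}\Psi^2_{1-\kappa}(w)\nabla_{1-\kappa}+c\otimes c\end{pmatrix}Q,$$ $$\frac{\partial S}{\partial(\alpha_1,\alpha_2,\kappa)}=Q^*\begin{pmatrix}-\mathrm{div}_\kappa\nabla_\kappa(u-w)&0&T_1\\ 0&-\mathrm{div}_{1-\kappa}\Psi^1_{1-\kappa}(w)&T_2\end{pmatrix},$$ where $$T_1=-\alpha_1\Big(\mathrm{div}-\frac{\partial}{\partial t^*}\Big)\nabla_\kappa(u-w)-\alpha_1\mathrm{div}_\kappa\Big(\nabla-\frac{\partial}{\partial t}\Big)(u-w),$$ $$T_2=-\alpha_2\Big(\frac{\partial}{\partial t^*}-\mathrm{div}\Big)\Psi^1_{1-\kappa}(w)-\alpha_2\mathrm{div}_{1-\kappa}\Psi^2_{1-\kappa}(w)\Big(\frac{\partial}{\partial t}-\nabla\Big)w.$$ Moreover $\frac{\partial S}{\partial(u,w)}:H^1(\Omega)^2\to(H^1(\Omega)^2)^*$ is boundedly invertible. 3. Let $(\alpha_1,\alpha_2,\kappa)$ be admissible and let $(u,w)=\hat R_{\gamma,\epsilon}(\alpha_1,\alpha_2,\kappa)$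 satisfy $\|\nabla_{1-\kappa}w(x)\|_2\ne\gamma$ for almost every $x\in\Omega$. Then $R=P_1\hat R_{\gamma,\epsilon}$ is Fréchet differentiable at $(\alpha_1,\alpha_2,\kappa)$ as a map into $H^1(\Omega)$, with $$\nabla R(\alpha_1,\alpha_2,\kappa)=-P_1\Big(\frac{\partial S}{\partial(u,w)}\Big)^{-1}\frac{\partial S}{\partial(\alpha_1,\alpha_2,\kappa)},$$ where the operators on the right are those of claim 2 at $(u,w)=\hat R_{\gamma,\epsilon}(\alpha_1,\alpha_2,\kappa)$. -/

import Mathlib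

open MeasureTheory Set Filter Topology
open scoped ContDiff RealInnerProductSpace

noncomputable section

namespace ICL2TV

/-- Space-time `ℝ³` with the coordinates `(x, y, t)`, indexed `0, 1, 2`. -/
abbrev E3 := EuclideanSpace ℝ (Fin 3)

/-- The interior cone property: there is one finite circular cone (radius `ρ`, half-angle
`arccos s`) such that every `x ∈ Ω` is the vertex of a congruent cone contained in `Ω`. -/
def ConeProperty (Ω : Set E3) : Prop :=
  ∃ ρ : ℝ, 0 < ρ ∧ ∃ s : ℝ, 0 < s ∧ s < 1 ∧
    ∀ x ∈ Ω, ∃ ξ : E3, ‖ξ‖ = 1 ∧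
      ∀ y : E3, ‖y‖ < ρ → s * ‖y‖ < ⟪ξ, y⟫ → x + y ∈ Ω

/-- A bounded, connected (in particular non-empty), open set of space-time with the cone
property. -/
structure Domain where
  carrier : Set E3
  isOpen : IsOpen carrier
  isConnected : IsConnected carrier
  isBounded : Bornology.IsBounded carrier
  cone : ConeProperty carrier

variable (Ω : Domain)

/-- Lebesgue measure on `Ω`. -/
abbrev Domain.vol : Measure E3 := volume.restrict Ω.carrier

instance : IsFiniteMeasure Ω.vol :=
  ⟨by
    rw [Measure.restrict_apply_univ]
    exact Ω.isBounded.measure_lt_top⟩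

/-- `L²(Ω)`. -/
abbrev L2 := Lp ℝ 2 Ω.vol

/-- `L²(Ω; ℝ³)`. -/
abbrev L2vec := Lp E3 2 Ω.vol

/-- `q ∈ L²(Ω; ℝ³)` is the weak gradient of `u ∈ L²(Ω)`. -/
def IsWeakGradient (u : L2 Ω) (q : L2vec Ω) : Prop :=
  ∀ φ : E3 → ℝ, ContDiff ℝ ∞ φ → HasCompactSupport φ → tsupport φ ⊆ Ω.carrier →
    ∀ i : Fin 3,
      ∫ x in Ω.carrier, u x * fderiv ℝ φ x (EuclideanSpace.single i 1)
        = - ∫ x in Ω.carrier, q x i * φ x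

theorem integrable_mul_test {Ω : Domain} {f : E3 → ℝ} (hf : Integrable f Ω.vol)
    {φ : E3 → ℝ} (hφ : Continuous φ) (hc : HasCompactSupport φ) :
    Integrable (fun x => f x * φ x) Ω.vol := by
  obtain ⟨C, hC⟩ := hφ.bounded_above_of_compact_support hc
  exact hf.mul_bdd hφ.aestronglyMeasurable (Eventually.of_forall hC)

theorem integrable_L2 {Ω : Domain} (u : L2 Ω) : Integrable u Ω.vol :=
  (Lp.memLp u).integrable (by norm_num)

theorem integrable_L2vec {Ω : Domain} (q : L2vec Ω) (i : Fin 3) :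
    Integrable (fun x => q x i) Ω.vol :=
  ((EuclideanSpace.proj (𝕜 := ℝ) i).integrable_comp ((Lp.memLp q).integrable (by norm_num)) :)

/-- The Sobolev space `H¹(Ω) = W^{1,2}(Ω)`, realised as the space of pairs `(u, ∇u)` inside the
Hilbert space `L²(Ω) × L²(Ω; ℝ³)`; its norm is `(‖u‖² + ‖∇u‖²)^{1/2}`. -/
def H1 : Submodule ℝ (WithLp 2 (L2 Ω × L2vec Ω)) where
  carrier := {z | IsWeakGradient Ω z.fst z.snd}
  zero_mem' := by
    intro φ _ _ _ i
    have h1 : ∀ᵐ x ∂Ω.vol, (0 : L2 Ω) x = 0 := Lp.coeFn_zero ℝ 2 Ω.vol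
    have h2 : ∀ᵐ x ∂Ω.vol, (0 : L2vec Ω) x = 0 := Lp.coeFn_zero E3 2 Ω.vol
    have e1 : ∫ x, (0 : L2 Ω) x * fderiv ℝ φ x (EuclideanSpace.single i 1) ∂Ω.vol = 0 :=
      integral_eq_zero_of_ae (by filter_upwards [h1] with x hx; rw [hx, zero_mul]; rfl)
    have e2 : ∫ x, (0 : L2vec Ω) x i * φ x ∂Ω.vol = 0 :=
      integral_eq_zero_of_ae (by filter_upwards [h2] with x hx; rw [hx, PiLp.zero_apply, zero_mul]; rfl)
    rw [WithLp.zero_fst, WithLp.zero_snd, e1, e2, neg_zero]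
  add_mem' := by
    intro a b ha hb φ hφ hc hs i
    have h1 := Lp.coeFn_add a.fst b.fst
    have h2 := Lp.coeFn_add a.snd b.snd
    have hd : Continuous (fun x => fderiv ℝ φ x (EuclideanSpace.single i 1)) :=
      (hφ.continuous_fderiv (by simp)).clm_apply continuous_const
    have hdc : HasCompactSupport (fun x => fderiv ℝ φ x (EuclideanSpace.single i 1)) :=
      hc.fderiv_apply ℝ _
    have e1 : ∫ x, (a.fst + b.fst : L2 Ω) x * fderiv ℝ φ x (EuclideanSpace.single i 1) ∂Ω.vol
        = ∫ x, (a.fst x * fderiv ℝ φ x (EuclideanSpace.single i 1)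
            + b.fst x * fderiv ℝ φ x (EuclideanSpace.single i 1)) ∂Ω.vol :=
      integral_congr_ae (by filter_upwards [h1] with x hx; rw [hx, Pi.add_apply, add_mul])
    have e2 : ∫ x, (a.snd + b.snd : L2vec Ω) x i * φ x ∂Ω.vol
        = ∫ x, (a.snd x i * φ x + b.snd x i * φ x) ∂Ω.vol :=
      integral_congr_ae (by
        filter_upwards [h2] with x hx; rw [hx, Pi.add_apply, PiLp.add_apply, add_mul])
    rw [WithLp.add_fst, WithLp.add_snd, e1, e2,
      integral_add (integrable_mul_test (integrable_L2 _) hd hdc)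
        (integrable_mul_test (integrable_L2 _) hd hdc),
      integral_add (integrable_mul_test (integrable_L2vec _ i) hφ.continuous hc)
        (integrable_mul_test (integrable_L2vec _ i) hφ.continuous hc),
      ha φ hφ hc hs i, hb φ hφ hc hs i, neg_add]
  smul_mem' := by
    intro c a ha φ hφ hc hs i
    have h1 := Lp.coeFn_smul c a.fst
    have h2 := Lp.coeFn_smul c a.snd
    have e1 : ∫ x, (c • a.fst : L2 Ω) x * fderiv ℝ φ x (EuclideanSpace.single i 1) ∂Ω.vol
        = ∫ x, c * (a.fst x * fderiv ℝ φ x (EuclideanSpace.single i 1)) ∂Ω.vol :=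
      integral_congr_ae (by
        filter_upwards [h1] with x hx; rw [hx, Pi.smul_apply, smul_eq_mul, mul_assoc])
    have e2 : ∫ x, (c • a.snd : L2vec Ω) x i * φ x ∂Ω.vol
        = ∫ x, c * (a.snd x i * φ x) ∂Ω.vol :=
      integral_congr_ae (by
        filter_upwards [h2] with x hx
        rw [hx, Pi.smul_apply, PiLp.smul_apply, smul_eq_mul, mul_assoc])
    rw [WithLp.smul_fst, WithLp.smul_snd, e1, e2, integral_const_mul, integral_const_mul,
      ha φ hφ hc hs i, mul_neg]

/-- The dual space `H¹(Ω)*`. -/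
abbrev H1dual := H1 Ω →L[ℝ] ℝ

/-! ### Derivative operators -/

/-- The embedding `H¹(Ω) → L²(Ω)`. -/
def val : H1 Ω →L[ℝ] L2 Ω := WithLp.fstL 2 ℝ (L2 Ω) (L2vec Ω) ∘L (H1 Ω).subtypeL

/-- The full weak gradient `(∂ₓ, ∂_y, ∂_t) : H¹(Ω) → L²(Ω; ℝ³)`. -/
def fullGrad : H1 Ω →L[ℝ] L2vec Ω := WithLp.sndL 2 ℝ (L2 Ω) (L2vec Ω) ∘L (H1 Ω).subtypeL

/-- The spatial gradient `∇ = (∂ₓ, ∂_y, 0)`. -/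
def gradSpace : H1 Ω →L[ℝ] L2vec Ω :=
  ContinuousLinearMap.compLpL 2 Ω.vol
    (Matrix.toEuclideanCLM (n := Fin 3) (𝕜 := ℝ) (Matrix.diagonal ![1, 1, 0])) ∘L fullGrad Ω

/-- The temporal derivative `∂/∂t`, placed in the third component: `(0, 0, ∂_t)`. -/
def gradTime : H1 Ω →L[ℝ] L2vec Ω :=
  ContinuousLinearMap.compLpL 2 Ω.vol
    (Matrix.toEuclideanCLM (n := Fin 3) (𝕜 := ℝ) (Matrix.diagonal ![0, 0, 1])) ∘L fullGrad Ω

/-- The anisotropic gradient `∇_κ = (κ ∂ₓ, κ ∂_y, (1 - κ) ∂_t)`. -/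
def gradK (κ : ℝ) : H1 Ω →L[ℝ] L2vec Ω := κ • gradSpace Ω + (1 - κ) • gradTime Ω

/-- For `G : H¹(Ω) → F` with `F` a Hilbert space, the adjoint `F → H¹(Ω)*`,
`q ↦ (φ ↦ ⟪q, G φ⟫)`. -/
def dualAdj {F : Type*} [NormedAddCommGroup F] [InnerProductSpace ℝ F] (G : H1 Ω →L[ℝ] F) :
    F →L[ℝ] H1dual Ω :=
  G.precomp ℝ ∘L (innerSL ℝ : F →L[ℝ] F →L[ℝ] ℝ)

/-- The spatial divergence, the negative adjoint of `gradSpace`. -/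
def divSpace : L2vec Ω →L[ℝ] H1dual Ω := -dualAdj Ω (gradSpace Ω)

/-- The temporal divergence `∂/∂t*`, the negative adjoint of `gradTime`. -/
def divTime : L2vec Ω →L[ℝ] H1dual Ω := -dualAdj Ω (gradTime Ω)

/-- The anisotropic divergence `div_κ`, the negative adjoint of `∇_κ`. -/
def divK (κ : ℝ) : L2vec Ω →L[ℝ] H1dual Ω := -dualAdj Ω (gradK Ω κ)

/-- The identity `I` in the Gelfand triple `H¹ ⊂ L² ⊂ (H¹)*`, i.e. `u ↦ (φ ↦ ∫ u φ)`. -/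
def idOp : H1 Ω →L[ℝ] H1dual Ω := dualAdj Ω (val Ω) ∘L val Ω

/-- The characteristic function `c = χ_Ω` as an element of `L²(Ω)`. -/
def chi : L2 Ω := Lp.const 2 Ω.vol (1 : ℝ)

/-- The functional `w ↦ ⟪c, w⟫ = ∫_Ω w`. -/
def cFun : H1dual Ω := dualAdj Ω (val Ω) (chi Ω)

/-- The rank-one operator `c ⊗ c : w ↦ ⟪c, w⟫ c`. -/
def cTensor : H1 Ω →L[ℝ] H1dual Ω := (cFun Ω).smulRight (cFun Ω)

/-! ### The Huber functional -/

/-- The Huber function `H_γ`. -/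
def huber (γ r : ℝ) : ℝ := if γ ≤ |r| then |r| - γ / 2 else 1 / (2 * γ) * |r| ^ 2

/-- `Θ(v) = ∫_Ω H_γ(‖v(x)‖) dx + (ε/2) ‖v‖²`. -/
def Theta (γ ε : ℝ) (v : L2vec Ω) : ℝ :=
  (∫ x in Ω.carrier, huber γ ‖v x‖) + ε / 2 * ‖v‖ ^ 2

/-- `M` is the Gâteaux derivative of `F` at `v`. -/
def HasGateauxDerivAt {E F : Type*} [NormedAddCommGroup E] [NormedSpace ℝ E]
    [NormedAddCommGroup F] [NormedSpace ℝ F] (f : E → F) (M : E →L[ℝ] F) (v : E) : Prop :=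
  ∀ ξ : E, HasLineDerivAt ℝ f (M ξ) v ξ

open Classical in
/-- The Gâteaux derivative of `f` at `v` (zero if there is none). -/
def gateauxDeriv {E F : Type*} [NormedAddCommGroup E] [NormedSpace ℝ E]
    [NormedAddCommGroup F] [NormedSpace ℝ F] (f : E → F) (v : E) : E →L[ℝ] F :=
  if h : ∃ M : E →L[ℝ] F, HasGateauxDerivAt f M v then h.choose else 0

/-- `Ψ¹_κ(u) = [∇Θ](∇_κ u)`. -/
def Psi1 (γ ε κ : ℝ) (u : H1 Ω) : L2vec Ω := gradient (Theta Ω γ ε) (gradK Ω κ u)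

/-- `Ψ²_κ(u) = [∇²Θ](∇_κ u)`. -/
def Psi2 (γ ε κ : ℝ) (u : H1 Ω) : L2vec Ω →L[ℝ] L2vec Ω :=
  gateauxDeriv (gradient (Theta Ω γ ε)) (gradK Ω κ u)

/-! ### The lower-level problem -/

/-- The state space of pairs `(u, w)`. -/
abbrev State := H1 Ω × H1 Ω

/-- Parameters `(α₁, α₂, κ)`. -/
abbrev Param := ℝ × ℝ × ℝ

/-- Admissible parameters: `α₁, α₂ > 0` and `κ ∉ {0, 1}`. -/
def admissible : Set Param := {p | 0 < p.1 ∧ 0 < p.2.1 ∧ p.2.2 ≠ 0 ∧ p.2.2 ≠ 1}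

variable (g : L2 Ω) (γ ε : ℝ)

/-- The functional `J_{γ,ε}(u, w, α₁, α₂, κ)`. -/
def J (p : Param) (z : State Ω) : ℝ :=
  1 / 2 * ‖val Ω z.1 - g‖ ^ 2
    + p.1 / 2 * ‖gradK Ω p.2.2 (z.1 - z.2)‖ ^ 2
    + p.2.1 * Theta Ω γ ε (gradK Ω (1 - p.2.2) z.2)
    + 1 / 2 * (∫ x in Ω.carrier, val Ω z.2 x) ^ 2

/-- The solution map `R̂_{γ,ε}(α₁, α₂, κ) = argmin_{(u,w)} J_{γ,ε}(u, w, α₁, α₂, κ)`. -/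
def Rhat (p : Param) : State Ω :=
  Classical.epsilon fun z => IsMinOn (J Ω g γ ε p) univ z

/-- `R = P₁ R̂_{γ,ε}` with `P₁(u, w) = u`. -/
def R (p : Param) : H1 Ω := (Rhat Ω g γ ε p).1

/-- `S = ∇_{(u,w)} J_{γ,ε}`, with values in the dual of the state space. -/
def S (p : Param) (z : State Ω) : State Ω →L[ℝ] ℝ := fderiv ℝ (J Ω g γ ε p) z

/-- `Q = (I, -I; 0, I)`. -/
def Q : State Ω →L[ℝ] State Ω :=
  (ContinuousLinearMap.fst ℝ (H1 Ω) (H1 Ω) - ContinuousLinearMap.snd ℝ (H1 Ω) (H1 Ω)).prod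
    (ContinuousLinearMap.snd ℝ (H1 Ω) (H1 Ω))

/-- `Q*`, after the identification of `H¹(Ω)* × H¹(Ω)*` with the dual of `H¹(Ω) × H¹(Ω)`:
`Q*(a, b) = ((u, w) ↦ a (u - w) + b w)`. -/
def Qadj : H1dual Ω × H1dual Ω →L[ℝ] (State Ω →L[ℝ] ℝ) :=
  (Q Ω).precomp ℝ ∘L
    (ContinuousLinearMap.coprodEquivL (𝕜 := ℝ) (E := H1 Ω) (F := H1 Ω) (G := ℝ) ℝ
      : (H1dual Ω × H1dual Ω) →L[ℝ] (State Ω →L[ℝ] ℝ))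

/-- The `2 × 2` operator matrix `(A, B; C, D)`. -/
def blockOp (A B C D : H1 Ω →L[ℝ] H1dual Ω) : State Ω →L[ℝ] H1dual Ω × H1dual Ω :=
  (A.coprod B).prod (C.coprod D)

/-- The operator `∂S/∂(u,w)`:
`Q* (I - α₁ div_κ ∇_κ, I; I, I - α₂ div_{1-κ} Ψ²_{1-κ}(w) ∇_{1-κ} + c ⊗ c) Q`. -/
def dSstate (p : Param) (z : State Ω) : State Ω →L[ℝ] (State Ω →L[ℝ] ℝ) :=
  Qadj Ω ∘L
    blockOp Ω
      (idOp Ω - p.1 • (divK Ω p.2.2 ∘L gradK Ω p.2.2))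
      (idOp Ω)
      (idOp Ω)
      (idOp Ω
        - p.2.1 • (divK Ω (1 - p.2.2) ∘L Psi2 Ω γ ε (1 - p.2.2) z.2 ∘L gradK Ω (1 - p.2.2))
        + cTensor Ω)
    ∘L Q Ω

/-- `T₁ = -α₁ (div - ∂/∂t*) ∇_κ(u-w) - α₁ div_κ (∇ - ∂/∂t)(u-w)`. -/
def T1 (p : Param) (z : State Ω) : H1dual Ω :=
  -(p.1 • (divSpace Ω - divTime Ω) (gradK Ω p.2.2 (z.1 - z.2)))
    - p.1 • divK Ω p.2.2 ((gradSpace Ω - gradTime Ω) (z.1 - z.2))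

/-- `T₂ = -α₂ (∂/∂t* - div) Ψ¹_{1-κ}(w) - α₂ div_{1-κ} Ψ²_{1-κ}(w) (∂/∂t - ∇) w`. -/
def T2 (p : Param) (z : State Ω) : H1dual Ω :=
  -(p.2.1 • (divTime Ω - divSpace Ω) (Psi1 Ω γ ε (1 - p.2.2) z.2))
    - p.2.1 • divK Ω (1 - p.2.2)
        (Psi2 Ω γ ε (1 - p.2.2) z.2 ((gradTime Ω - gradSpace Ω) z.2))

/-- The `2 × 3` matrix with the given columns, as an operator on parameter increments. -/
def columns (a b c : H1dual Ω × H1dual Ω) : Param →L[ℝ] H1dual Ω × H1dual Ω :=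
  (ContinuousLinearMap.toSpanSingleton ℝ a).coprod
    ((ContinuousLinearMap.toSpanSingleton ℝ b).coprod (ContinuousLinearMap.toSpanSingleton ℝ c))

/-- The operator `∂S/∂(α₁,α₂,κ)`:
`Q* (-div_κ ∇_κ(u-w), 0, T₁; 0, -div_{1-κ} Ψ¹_{1-κ}(w), T₂)`. -/
def dSparam (p : Param) (z : State Ω) : Param →L[ℝ] (State Ω →L[ℝ] ℝ) :=
  Qadj Ω ∘L
    columns Ω
      (-divK Ω p.2.2 (gradK Ω p.2.2 (z.1 - z.2)), 0)
      (0, -divK Ω (1 - p.2.2) (Psi1 Ω γ ε (1 - p.2.2) z.2))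
      (T1 Ω p z, T2 Ω γ ε p z)

/-- `|∇_{1-κ} w| ≠ γ` almost everywhere: the gradient avoids the kink of the derivative of the
Huber function, the sphere on which that function is not twice differentiable. -/
def AvoidsKink (p : Param) (z : State Ω) : Prop :=
  ∀ᵐ x ∂Ω.vol, ‖gradK Ω (1 - p.2.2) z.2 x‖ ≠ γ

end ICL2TV

end

/-! Everything rests on strong convexity. By the Poincaré inequality on `Ω`, the quadratic terms of
`J` (fidelity, anisotropic gradient of `u - w`, the `ε`-part of `Θ`, squared mean of `w`) control
the full `H¹` norm of `(u, w)` for admissible parameters. Hence `J` lies above its tangent planes by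
`m p * ‖δ‖ ^ 2`, with `m` continuous in the parameters (`exists_strongSupport_J`). This gives
existence and uniqueness of the minimiser, coercivity of every Gâteaux derivative of `S` and thus
its invertibility by Lax–Milgram, and the error bound `m q * ‖Rhat q - y‖ ≤ ‖S q y‖` for every state
`y`.

The usual implicit function theorem is not available: superposition with the Huber gradient is
Lipschitz on `L²`, but it is only shown to be Gâteaux differentiable, where the argument avoids the
kink. It is replaced by two observations. A Lipschitz, Gâteaux differentiable map composed with a
Fréchet differentiable map from a finite-dimensional space is Fréchet differentiable
(`HasGateauxDerivAt.comp_hasFDerivAt`). So `q ↦ S q (Rhat p + L (q - p))` is Fréchet differentiable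
at `p`, and its derivative vanishes when `L` solves the linearised equation. The error bound then
turns `S q (Rhat p + L (q - p)) = o(q - p)` into `Rhat q - Rhat p - L (q - p) = o(q - p)`
(`hasFDerivAt_of_error_bound`).

All derivatives of `S` come from the single chain rule `hasFDerivAt_S`, applied to a line of states,
to a fixed state with varying parameters, and to the affine family above.

The Poincaré inequality is proved without compactness. Differences `u y - u x` over pairs joined by
a segment in `Ω` are square integrable, with a bound by the gradient
(`exists_lintegral_visDiff_le`). By the cone property each point sees one of finitely many balls in
`Ω`, and connectedness links the averages of `u` over these balls. -/

namespace ICL2TV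

/-! ### Test functions and `L²` duality -/

/-- `φ` is a test function on `V`: smooth, with compact support contained in `V`. -/
structure IsTest (V : Set E3) (φ : E3 → ℝ) : Prop where
  contDiff : ContDiff ℝ ∞ φ
  compact : HasCompactSupport φ
  supp : tsupport φ ⊆ V

namespace IsTest

variable {V W : Set E3} {φ ψ : E3 → ℝ}

theorem memLp (h : IsTest V φ) (μ : Measure E3) [IsFiniteMeasureOnCompacts μ] : MemLp φ 2 μ :=
  h.contDiff.continuous.memLp_of_hasCompactSupport h.compact

theorem add (h : IsTest V φ) (k : IsTest V ψ) : IsTest V (φ + ψ) :=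
  ⟨h.contDiff.add k.contDiff, h.compact.add k.compact,
    (tsupport_add φ ψ).trans (union_subset h.supp k.supp)⟩

theorem const_smul (c : ℝ) (h : IsTest V φ) : IsTest V (c • φ) :=
  ⟨contDiff_const.smul h.contDiff, h.compact.smul_left (f := fun _ => c),
    (tsupport_smul_subset_right (fun _ => c) φ).trans h.supp⟩

theorem zero : IsTest V 0 :=
  ⟨contDiff_const, HasCompactSupport.zero, by simp [tsupport]⟩

theorem eq_zero_of_notMem (h : IsTest V φ) {x : E3} (hx : x ∉ V) : φ x = 0 :=
  image_eq_zero_of_notMem_tsupport fun h' => hx (h.supp h')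

theorem translate (h : IsTest V φ) (a : E3) (hVW : ∀ x ∈ V, x + a ∈ W) :
    IsTest W (fun y => φ (y - a)) := by
  refine ⟨h.contDiff.comp (contDiff_id.sub contDiff_const), ?_, ?_⟩
  · exact h.compact.comp_homeomorph (Homeomorph.subRight a)
  · have : tsupport (fun y => φ (y - a)) = (Homeomorph.subRight a) ⁻¹' tsupport φ :=
      tsupport_comp_eq_preimage φ (Homeomorph.subRight a)
    rw [this]
    intro y hy
    have := hVW _ (h.supp hy)
    simpa using this

end IsTest

/-- Duality characterisation of the `L²(V)` norm through test functions. -/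
theorem eLpNorm_le_of_test {V : Set E3} (hV : IsOpen V) {f : E3 → ℝ}
    (hf : MemLp f 2 (volume.restrict V)) {K : ℝ} (hK : 0 ≤ K)
    (h : ∀ φ, IsTest V φ →
      |∫ x in V, f x * φ x| ≤ K * (eLpNorm φ 2 (volume.restrict V)).toReal) :
    eLpNorm f 2 (volume.restrict V) ≤ ENNReal.ofReal K := by
  set μ : Measure E3 := volume.restrict V
  let W : Submodule ℝ (Lp ℝ 2 μ) :=
    { carrier := {ψ | ∃ φ, IsTest V φ ∧ ψ =ᵐ[μ] φ}
      add_mem' := by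
        rintro a b ⟨φ, h1, h2⟩ ⟨ψ, h3, h4⟩
        exact ⟨φ + ψ, h1.add h3, (Lp.coeFn_add a b).trans (h2.add h4)⟩
      zero_mem' := ⟨0, IsTest.zero, Lp.coeFn_zero _ _ _⟩
      smul_mem' := by
        rintro c a ⟨φ, h1, h2⟩
        exact ⟨c • φ, h1.const_smul c, (Lp.coeFn_smul c a).trans (h2.const_smul c)⟩ }
  -- Test functions are dense: an element orthogonal to all of them vanishes by the fundamental
  -- lemma of the calculus of variations.
  have hW : W.topologicalClosure = ⊤ := by
    rw [Submodule.topologicalClosure_eq_top_iff, Submodule.eq_bot_iff]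
    intro k hk
    rw [Submodule.mem_orthogonal'] at hk
    have hz : ∀ᵐ x ∂μ, x ∈ V → k x = 0 := by
      refine hV.ae_eq_zero_of_integral_contDiff_smul_eq_zero
        (((Lp.memLp k).locallyIntegrable (by norm_num)).locallyIntegrableOn V) ?_
      intro φ h1 h2 h3
      have ht : IsTest V φ := ⟨h1, h2, h3⟩
      have h4 := hk ((ht.memLp μ).toLp φ) ⟨φ, ht, (ht.memLp μ).coeFn_toLp⟩
      rw [L2.inner_def] at h4
      rw [← h4]
      refine integral_congr_ae ?_
      filter_upwards [(ht.memLp μ).coeFn_toLp] with x hx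
      rw [hx]
      simp
    rw [Lp.eq_zero_iff_ae_eq_zero]
    filter_upwards [hz, ae_restrict_mem hV.measurableSet] with x hx hxV using hx hxV
  set F : Lp ℝ 2 μ := hf.toLp f
  have hall : ∀ ψ : Lp ℝ 2 μ, |⟪F, ψ⟫| ≤ K * ‖ψ‖ := by
    intro ψ
    have hψ : ψ ∈ closure (W : Set (Lp ℝ 2 μ)) := by
      rw [← Submodule.topologicalClosure_coe, hW]; trivial
    refine closure_minimal (t := {ψ : Lp ℝ 2 μ | |⟪F, ψ⟫| ≤ K * ‖ψ‖}) ?_ ?_ hψ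
    · rintro ψ ⟨φ, h1, h2⟩
      have e1 : ⟪F, ψ⟫ = ∫ x in V, f x * φ x := by
        rw [L2.inner_def]
        refine integral_congr_ae ?_
        filter_upwards [hf.coeFn_toLp, h2] with x hx hx2
        rw [hx, hx2]
        simp [mul_comm]
      have e2 : ‖ψ‖ = (eLpNorm φ 2 μ).toReal := by
        rw [Lp.norm_def, eLpNorm_congr_ae h2]
      rw [mem_ofPred_eq, e1, e2]
      exact h φ h1
    · exact isClosed_le (by fun_prop) (by fun_prop)
  have hFK : ‖F‖ ≤ K := by
    have h1 := hall F
    rw [real_inner_self_eq_norm_sq, abs_of_nonneg (by positivity), sq] at h1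
    by_contra! hlt
    have : 0 < ‖F‖ := hK.trans_lt hlt
    nlinarith
  have : eLpNorm f 2 μ = ENNReal.ofReal ‖F‖ := by
    rw [Lp.norm_toLp, ENNReal.ofReal_toReal hf.eLpNorm_ne_top]
  rw [this]
  exact ENNReal.ofReal_le_ofReal hFK

/-! ### Difference quotients of Sobolev functions -/

variable {Ω : Domain}

theorem IsWeakGradient.integral_mul_fderiv {u : L2 Ω} {q : L2vec Ω} (h : IsWeakGradient Ω u q)
    {φ : E3 → ℝ} (hφ : IsTest Ω.carrier φ) (a : E3) :
    ∫ x in Ω.carrier, u x * fderiv ℝ φ x a = - ∫ x in Ω.carrier, ⟪q x, a⟫ * φ x := by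
  have ha : a = ∑ i, a i • EuclideanSpace.single i (1 : ℝ) := by
    ext j; simp [Finset.sum_apply, Pi.single_apply]
  have hi : ∀ i : Fin 3, Continuous fun x => fderiv ℝ φ x (EuclideanSpace.single i 1) := fun i =>
    (hφ.contDiff.continuous_fderiv (by simp)).clm_apply continuous_const
  have hL : ∀ x, u x * fderiv ℝ φ x a
      = ∑ i, a i * (u x * fderiv ℝ φ x (EuclideanSpace.single i 1)) := by
    intro x
    conv_lhs => rw [ha, map_sum, Finset.mul_sum]
    refine Finset.sum_congr rfl fun i _ => ?_
    rw [map_smul, smul_eq_mul]; ring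
  have hR : ∀ x, ⟪q x, a⟫ * φ x = ∑ i, a i * (q x i * φ x) := by
    intro x
    rw [PiLp.inner_apply, Finset.sum_mul]
    refine Finset.sum_congr rfl fun i _ => ?_
    simp; ring
  simp_rw [hL, hR]
  rw [integral_finsetSum, integral_finsetSum, ← Finset.sum_neg_distrib]
  · refine Finset.sum_congr rfl fun i _ => ?_
    rw [integral_const_mul, integral_const_mul, h φ hφ.contDiff hφ.compact hφ.supp i]
    ring
  · exact fun i _ => (integrable_mul_test (integrable_L2vec q i) hφ.contDiff.continuous
      hφ.compact).const_mul _
  · exact fun i _ => (integrable_mul_test (integrable_L2 u) (hi i)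
      (hφ.compact.fderiv_apply ℝ _)).const_mul _

theorem abs_integral_inner_mul_le (q : L2vec Ω) (a : E3) {φ : E3 → ℝ} (hφ : MemLp φ 2 Ω.vol) :
    |∫ x in Ω.carrier, ⟪q x, a⟫ * φ x| ≤ ‖a‖ * ‖q‖ * (eLpNorm φ 2 Ω.vol).toReal := by
  have hm : MemLp (fun x => φ x • a) 2 Ω.vol := by
    exact (ContinuousLinearMap.toSpanSingleton ℝ a).comp_memLp' hφ
  have e1 : ∫ x in Ω.carrier, ⟪q x, a⟫ * φ x = ⟪q, hm.toLp _⟫ := by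
    rw [L2.inner_def]
    refine integral_congr_ae ?_
    filter_upwards [hm.coeFn_toLp] with x hx
    rw [hx, inner_smul_right]; ring
  have e2 : ‖hm.toLp _‖ = ‖a‖ * (eLpNorm φ 2 Ω.vol).toReal := by
    have : eLpNorm (fun x => φ x • a) 2 Ω.vol = eLpNorm (fun x => ‖a‖ • φ x) 2 Ω.vol :=
      eLpNorm_congr_norm_ae (Eventually.of_forall fun x => by simp [norm_smul, mul_comm])
    rw [Lp.norm_toLp, this]
    have := eLpNorm_const_smul ‖a‖ φ 2 Ω.vol
    rw [show (fun x => ‖a‖ • φ x) = ‖a‖ • φ from rfl, this]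
    simp
  rw [e1]
  refine (abs_real_inner_le_norm _ _).trans_eq ?_
  rw [e2]; ring

/-- The `L²` estimate for difference quotients of a Sobolev function. -/
theorem IsWeakGradient.eLpNorm_translate_sub_le {u : L2 Ω} {q : L2vec Ω}
    (hu : IsWeakGradient Ω u q) {V : Set E3} (hV : IsOpen V) (a : E3)
    (hVΩ : ∀ x ∈ V, ∀ s ∈ Icc (0 : ℝ) 1, x + s • a ∈ Ω.carrier) :
    eLpNorm (fun x => u (x + a) - u x) 2 (volume.restrict V) ≤ ENNReal.ofReal (‖a‖ * ‖q‖) := by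
  have h0 : ∀ x ∈ V, x ∈ Ω.carrier := fun x hx => by simpa using hVΩ x hx 0 (by simp)
  have h1 : ∀ x ∈ V, x + a ∈ Ω.carrier := fun x hx => by simpa using hVΩ x hx 1 (by simp)
  have m0 : MemLp u 2 (volume.restrict V) :=
    (Lp.memLp u).mono_measure (Measure.restrict_mono_set _ h0)
  have m1 : MemLp (fun x => u (x + a)) 2 (volume.restrict V) := by
    have hmp : MeasurePreserving (fun x : E3 => x + a)
        (volume.restrict ((fun x => x + a) ⁻¹' Ω.carrier)) Ω.vol :=
      (measurePreserving_add_right volume a).restrict_preimage Ω.isOpen.measurableSet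
    exact ((Lp.memLp u).comp_measurePreserving hmp).mono_measure
      (Measure.restrict_mono_set _ h1)
  have i0 : ∀ {φ : E3 → ℝ}, IsTest V φ → Integrable (fun x => u x * φ x) (volume.restrict V) :=
    fun hφ => m0.integrable_mul (hφ.memLp _)
  have i1 : ∀ {φ : E3 → ℝ}, IsTest V φ →
      Integrable (fun x => u (x + a) * φ x) (volume.restrict V) :=
    fun hφ => m1.integrable_mul (hφ.memLp _)
  refine eLpNorm_le_of_test hV (m1.sub m0) (by positivity) fun φ hφ => ?_
  -- The translation is put on the smooth factor, so that `F` is differentiable although `u` is only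
  -- `L²`. Then `F 1 - F 0` is the pairing of the difference of `u` with `φ`.
  let F : ℝ → ℝ := fun s => ∫ y in Ω.carrier, u y * φ (y - s • a)
  have hd : Continuous (fun x => fderiv ℝ φ x a) :=
    (hφ.contDiff.continuous_fderiv (by simp)).clm_apply continuous_const
  obtain ⟨B, hB⟩ := hd.bounded_above_of_compact_support (hφ.compact.fderiv_apply ℝ a)
  have hF : ∀ s : ℝ, HasDerivAt F (∫ y in Ω.carrier, u y * -(fderiv ℝ φ (y - s • a) a)) s := by
    intro s
    refine (hasDerivAt_integral_of_dominated_loc_of_deriv_le (μ := Ω.vol)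
      (F := fun s y => u y * φ (y - s • a)) (F' := fun s y => u y * -(fderiv ℝ φ (y - s • a) a))
      (bound := fun y => ‖u y‖ * B) (s := univ) univ_mem ?_ ?_ ?_ ?_ ?_ ?_).2
    · exact Eventually.of_forall fun t => (Lp.aestronglyMeasurable u).mul
        (hφ.contDiff.continuous.comp (by fun_prop)).aestronglyMeasurable
    · exact integrable_mul_test (integrable_L2 u) (hφ.contDiff.continuous.comp (by fun_prop))
        (hφ.translate (W := univ) (s • a) (by simp)).compact
    · exact (Lp.aestronglyMeasurable u).mul (hd.comp (by fun_prop)).neg.aestronglyMeasurable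
    · refine Eventually.of_forall fun y t _ => ?_
      rw [norm_mul, norm_neg]
      gcongr
      exact hB _
    · exact (integrable_L2 u).norm.mul_const B
    · refine Eventually.of_forall fun y t _ => ?_
      have e1 : HasDerivAt (fun t : ℝ => y - t • a) (-a) t := by
        simpa using ((hasDerivAt_id t).smul_const a).const_sub y
      have e2 := ((hφ.contDiff.differentiable (by simp)) (y - t • a)).hasFDerivAt.comp_hasDerivAt t e1
      simpa using e2.const_mul (u y)
  -- For `s ∈ [0, 1]` the translate of `φ` is still supported in `Ω`, so the weak gradient may be
  -- tested with it; its `L²` norm does not depend on `s`.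
  have hle : ∀ s ∈ Icc (0 : ℝ) 1, ‖∫ y in Ω.carrier, u y * -(fderiv ℝ φ (y - s • a) a)‖
      ≤ ‖a‖ * ‖q‖ * (eLpNorm φ 2 (volume.restrict V)).toReal := by
    intro s hs
    have ht := hφ.translate (W := Ω.carrier) (s • a) fun x hx => hVΩ x hx s hs
    have e1 : ∀ y, fderiv ℝ φ (y - s • a) a = fderiv ℝ (fun y => φ (y - s • a)) y a := by
      intro y; rw [fderiv_comp_sub]
    simp_rw [mul_neg, e1]
    rw [integral_neg, hu.integral_mul_fderiv ht, neg_neg, Real.norm_eq_abs]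
    refine (abs_integral_inner_mul_le q a (ht.memLp _)).trans ?_
    gcongr
    · exact (hφ.memLp _).eLpNorm_ne_top
    · calc eLpNorm (fun y => φ (y - s • a)) 2 Ω.vol
          ≤ eLpNorm (fun y => φ (y - s • a)) 2 volume :=
            eLpNorm_mono_measure _ Measure.restrict_le_self
        _ = eLpNorm φ 2 volume :=
            eLpNorm_comp_measurePreserving (p := 2) hφ.contDiff.continuous.aestronglyMeasurable
              (measurePreserving_sub_right volume (s • a))
        _ = eLpNorm φ 2 (volume.restrict V) := by
            rw [← eLpNorm_indicator_eq_eLpNorm_restrict hV.measurableSet]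
            congr 1
            exact (indicator_eq_self.2 fun x hx => by
              by_contra hxV; exact hx (hφ.eq_zero_of_notMem hxV)).symm
  have key := norm_image_sub_le_of_norm_deriv_le_segment_01' (f := F)
    (fun s _ => (hF s).hasDerivWithinAt) fun s hs => hle s (Ico_subset_Icc_self hs)
  have e0 : F 0 = ∫ x in V, u x * φ x := by
    simp only [F, zero_smul, sub_zero]
    rw [setIntegral_eq_integral_of_forall_compl_eq_zero,
      setIntegral_eq_integral_of_forall_compl_eq_zero]
    · intro x hx; rw [hφ.eq_zero_of_notMem hx, mul_zero]
    · intro x hx; rw [hφ.eq_zero_of_notMem fun h => hx (h0 x h), mul_zero]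
  have e1 : F 1 = ∫ x in V, u (x + a) * φ x := by
    simp only [F, one_smul]
    rw [setIntegral_eq_integral_of_forall_compl_eq_zero,
      setIntegral_eq_integral_of_forall_compl_eq_zero,
      ← integral_add_right_eq_self _ a]
    · simp
    · intro x hx; rw [hφ.eq_zero_of_notMem hx, mul_zero]
    · intro x hx
      rw [hφ.eq_zero_of_notMem fun h => hx (by simpa using h1 _ h), mul_zero]
  rw [e0, e1, ← integral_sub (i1 hφ) (i0 hφ), Real.norm_eq_abs] at key
  simpa only [Pi.sub_apply, sub_mul] using key

/-! ### Pairs of mutually visible points -/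

/-- The pairs of points of `Ω` that see each other: the segment between them lies in `Ω`. -/
def Domain.visible (Ω : Domain) : Set (E3 × E3) :=
  {p | ∀ s ∈ Icc (0 : ℝ) 1, p.1 + s • (p.2 - p.1) ∈ Ω.carrier}

/-- The parameter interval of the segment is compact, so a neighbourhood can be chosen uniformly
along it. -/
theorem Domain.isOpen_visible (Ω : Domain) : IsOpen Ω.visible := by
  rw [isOpen_iff_mem_nhds]
  intro p hp
  refine isCompact_Icc.eventually_forall_of_forall_eventually fun s hs => ?_
  have hc : Continuous fun z : (E3 × E3) × ℝ => z.1.1 + z.2 • (z.1.2 - z.1.1) := by fun_prop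
  exact hc.continuousAt.eventually (Ω.isOpen.mem_nhds (hp s hs))

theorem Domain.visible_left {x y : E3} (h : (x, y) ∈ Ω.visible) : x ∈ Ω.carrier := by
  simpa using h 0 (by simp)

theorem Domain.visible_right {x y : E3} (h : (x, y) ∈ Ω.visible) : y ∈ Ω.carrier := by
  simpa using h 1 (by simp)

theorem Domain.visible_of_convex {U : Set E3} (hU : Convex ℝ U) (hΩ : U ⊆ Ω.carrier) {x y : E3}
    (hx : x ∈ U) (hy : y ∈ U) : (x, y) ∈ Ω.visible :=
  fun _ hs => hΩ (hU.add_smul_sub_mem hx hy hs)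

/-- The squared difference of the values of `u` at two points that see each other. -/
noncomputable def visDiff (u : L2 Ω) (x y : E3) : ENNReal :=
  Ω.visible.indicator (fun p => ‖u p.2 - u p.1‖ₑ ^ 2) (x, y)

theorem measurable_visDiff (u : L2 Ω) : Measurable fun p : E3 × E3 => visDiff u p.1 p.2 := by
  have hu : Measurable u := (Lp.stronglyMeasurable u).measurable
  exact (((hu.comp measurable_snd).sub (hu.comp measurable_fst)).enorm.pow_const 2).indicator
    Ω.isOpen_visible.measurableSet

theorem sq_eLpNorm_two {F : Type*} [NormedAddCommGroup F] {μ : Measure E3} (f : E3 → F) :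
    eLpNorm f 2 μ ^ 2 = ∫⁻ x, ‖f x‖ₑ ^ 2 ∂μ := by
  rw [eLpNorm_eq_lintegral_rpow_enorm_toReal (by simp) (by simp), ← ENNReal.rpow_natCast,
    ← ENNReal.rpow_mul]
  simp

/-- Substitute `y = x + a` and exchange the integrals: for fixed `a` the inner integral is the
squared norm of a difference quotient, and only the bounded set `‖a‖ ≤ 2 * d` contributes. -/
theorem exists_lintegral_visDiff_le (Ω : Domain) :
    ∃ C : ENNReal, C ≠ ⊤ ∧ ∀ (u : L2 Ω) (q : L2vec Ω), IsWeakGradient Ω u q →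
      ∫⁻ x, ∫⁻ y, visDiff u x y ≤ C * ‖q‖ₑ ^ 2 := by
  obtain ⟨d, hd⟩ := Ω.isBounded.exists_norm_le
  have hd0 : 0 ≤ d := by
    obtain ⟨x, hx⟩ := Ω.isConnected.nonempty
    exact (norm_nonneg x).trans (hd x hx)
  refine ⟨volume (Metric.closedBall (0 : E3) (2 * d)) * ENNReal.ofReal (2 * d) ^ 2,
    ENNReal.mul_ne_top measure_closedBall_lt_top.ne
    (ENNReal.pow_ne_top ENNReal.ofReal_ne_top), fun u q hu => ?_⟩
  have hslice : ∀ a : E3, ∫⁻ x, visDiff u x (x + a)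
      ≤ (Metric.closedBall (0 : E3) (2 * d)).indicator
        (fun _ => (ENNReal.ofReal (2 * d) * ‖q‖ₑ) ^ 2) a := by
    intro a
    let V : Set E3 := (fun x => (x, x + a)) ⁻¹' Ω.visible
    have hV : IsOpen V := Ω.isOpen_visible.preimage (by fun_prop)
    have e : ∀ x, visDiff u x (x + a) = V.indicator (fun x => ‖u (x + a) - u x‖ₑ ^ 2) x :=
      fun x => rfl
    simp_rw [e]
    rw [lintegral_indicator hV.measurableSet]
    by_cases ha : a ∈ Metric.closedBall (0 : E3) (2 * d)
    · rw [indicator_of_mem ha, ← sq_eLpNorm_two]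
      gcongr
      refine (hu.eLpNorm_translate_sub_le hV a fun x hx s hs => ?_).trans ?_
      · simpa using hx s hs
      · rw [ENNReal.ofReal_mul (norm_nonneg a), ofReal_norm q]
        gcongr
        simpa using ha
    -- Both endpoints of a visible pair lie in `Ω`, hence have norm at most `d`, and their
    -- difference has norm at most `2 * d`.
    · have : V = ∅ := by
        refine eq_empty_of_forall_notMem fun x hx => ha ?_
        rw [mem_closedBall_zero_iff]
        have h1 := hd _ (Domain.visible_left hx)
        have h2 := hd _ (Domain.visible_right hx)
        calc ‖a‖ = ‖(x + a) - x‖ := by simp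
          _ ≤ ‖x + a‖ + ‖x‖ := norm_sub_le _ _
          _ ≤ 2 * d := by linarith
      rw [this]; simp
  have hm : Measurable fun p : E3 × E3 => visDiff u p.1 (p.1 + p.2) :=
    (measurable_visDiff u).comp (measurable_fst.prodMk (measurable_fst.add measurable_snd))
  calc ∫⁻ x, ∫⁻ y, visDiff u x y = ∫⁻ x, ∫⁻ a, visDiff u x (x + a) :=
        lintegral_congr fun x => (lintegral_add_left_eq_self (visDiff u x) x).symm
    _ = ∫⁻ a, ∫⁻ x, visDiff u x (x + a) := lintegral_lintegral_swap hm.aemeasurable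
    _ ≤ ∫⁻ a, (Metric.closedBall (0 : E3) (2 * d)).indicator
        (fun _ => (ENNReal.ofReal (2 * d) * ‖q‖ₑ) ^ 2) a := lintegral_mono hslice
    _ = _ := by
        rw [lintegral_indicator Metric.isClosed_closedBall.measurableSet, setLIntegral_const]
        ring

/-! ### Averages over balls -/

/-- Jensen's inequality, in the form that `L¹` norms are at most `L²` norms for the normalised
measure on `B`. -/
theorem enorm_average_sq_le {B : Set E3} (h0 : volume B ≠ 0) (h1 : volume B ≠ ⊤) {f : E3 → ℝ}
    (hf : AEStronglyMeasurable f (volume.restrict B)) :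
    ‖⨍ y in B, f y‖ₑ ^ 2 ≤ (volume B)⁻¹ * ∫⁻ y in B, ‖f y‖ₑ ^ 2 := by
  set P : Measure E3 := ((volume.restrict B) univ)⁻¹ • volume.restrict B
  have hP : IsProbabilityMeasure P := by
    refine ⟨?_⟩
    simp [P, ENNReal.inv_mul_cancel h0 h1]
  calc ‖⨍ y in B, f y‖ₑ ^ 2 = ‖∫ y, f y ∂P‖ₑ ^ 2 := rfl
    _ ≤ (eLpNorm f 2 P) ^ 2 := by
        gcongr
        refine (enorm_integral_le_lintegral_enorm f).trans ?_
        rw [← eLpNorm_one_eq_lintegral_enorm]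
        exact eLpNorm_le_eLpNorm_of_exponent_le (by norm_num) (hf.smul_measure _)
    _ = _ := by
        rw [sq_eLpNorm_two]
        simp [P, lintegral_smul_measure]

theorem average_sub_const {B : Set E3} (h0 : volume B ≠ 0) (h1 : volume B ≠ ⊤) {f : E3 → ℝ}
    (hf : IntegrableOn f B) (c : ℝ) : ⨍ y in B, (f y - c) = (⨍ y in B, f y) - c := by
  have hc : IntegrableOn (fun _ => c) B := integrableOn_const h1
  have : ⨍ _ in B, c = c := setAverage_const h0 h1 c
  conv_rhs => rw [← this]
  rw [setAverage_eq, setAverage_eq, setAverage_eq, integral_sub hf hc, smul_sub]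

theorem integrableOn_L2 (u : L2 Ω) {B : Set E3} (hB : B ⊆ Ω.carrier) : IntegrableOn u B :=
  (show IntegrableOn u Ω.carrier volume from integrable_L2 u).mono_set hB

/-- The value of `u` at a point that sees all of `B` is close to the average over `B`. -/
theorem enorm_sub_average_sq_le (u : L2 Ω) {B : Set E3} (hB : MeasurableSet B)
    (h0 : volume B ≠ 0) (h1 : volume B ≠ ⊤) {x : E3} (hv : ∀ y ∈ B, (x, y) ∈ Ω.visible) :
    ‖u x - ⨍ y in B, u y‖ₑ ^ 2 ≤ (volume B)⁻¹ * ∫⁻ y, visDiff u x y := by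
  have hi : IntegrableOn u B := integrableOn_L2 u fun y hy => Domain.visible_right (hv y hy)
  rw [← enorm_neg, neg_sub, ← average_sub_const h0 h1 hi]
  refine (enorm_average_sq_le h0 h1
    (hi.sub (integrableOn_const h1 : IntegrableOn (fun _ => u x) B)).aestronglyMeasurable).trans ?_
  refine mul_le_mul' le_rfl ?_
  rw [← lintegral_indicator hB]
  refine lintegral_mono fun y => ?_
  by_cases hy : y ∈ B
  · rw [indicator_of_mem hy, visDiff, indicator_of_mem (hv y hy)]; exact le_rfl
  · rw [indicator_of_notMem hy]; exact zero_le

/-- The averages over `B` and `B'` differ by at most a multiple of the norm of the gradient. -/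
def Linked (Ω : Domain) (B B' : Set E3) : Prop :=
  ∃ C : ℝ, 0 ≤ C ∧ ∀ (u : L2 Ω) (q : L2vec Ω), IsWeakGradient Ω u q →
    ‖(⨍ y in B, u y) - ⨍ y in B', u y‖ ≤ C * ‖q‖

theorem Linked.symm {B B' : Set E3} (h : Linked Ω B B') : Linked Ω B' B := by
  obtain ⟨C, h0, hC⟩ := h
  exact ⟨C, h0, fun u q hu => by rw [norm_sub_rev]; exact hC u q hu⟩

theorem Linked.trans {B B' B'' : Set E3} (h : Linked Ω B B') (h' : Linked Ω B' B'') :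
    Linked Ω B B'' := by
  obtain ⟨C, h0, hC⟩ := h
  obtain ⟨C', h0', hC'⟩ := h'
  refine ⟨C + C', by positivity, fun u q hu => ?_⟩
  calc _ ≤ _ := norm_sub_le_norm_sub_add_norm_sub _ (⨍ y in B', u y) _
    _ ≤ C * ‖q‖ + C' * ‖q‖ := add_le_add (hC u q hu) (hC' u q hu)
    _ = _ := by ring

theorem norm_le_sqrt_mul_of_enorm_sq_le {F G : Type*} [SeminormedAddCommGroup F]
    [SeminormedAddCommGroup G] {a : F} {b : G} {K : ENNReal} (hK : K ≠ ⊤)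
    (h : ‖a‖ₑ ^ 2 ≤ K * ‖b‖ₑ ^ 2) : ‖a‖ ≤ √K.toReal * ‖b‖ := by
  have h1 := ENNReal.toReal_mono (ENNReal.mul_ne_top hK (by simp)) h
  rw [ENNReal.toReal_mul, ENNReal.toReal_pow, ENNReal.toReal_pow, toReal_enorm, toReal_enorm] at h1
  refine (abs_le_of_sq_le_sq' ?_ (by positivity)).2
  rw [mul_pow, Real.sq_sqrt ENNReal.toReal_nonneg]
  exact h1

/-- Averaging over `x ∈ B` the pointwise bound for the distance of `u x` to the mean over `B'`
leaves the double integral of `visDiff`. -/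
theorem linked_of_visible {B B' : Set E3} (hB : MeasurableSet B) (hB' : MeasurableSet B')
    (h0 : volume B ≠ 0) (h1 : volume B ≠ ⊤) (h0' : volume B' ≠ 0) (h1' : volume B' ≠ ⊤)
    (hv : ∀ x ∈ B, ∀ y ∈ B', (x, y) ∈ Ω.visible) : Linked Ω B B' := by
  obtain ⟨C, hC, hD⟩ := exists_lintegral_visDiff_le Ω
  have hK : (volume B)⁻¹ * ((volume B')⁻¹ * C) ≠ ⊤ :=
    ENNReal.mul_ne_top (by simp [h0]) (ENNReal.mul_ne_top (by simp [h0']) hC)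
  refine ⟨_, Real.sqrt_nonneg _, fun u q hu => norm_le_sqrt_mul_of_enorm_sq_le hK ?_⟩
  have hne : B'.Nonempty := nonempty_of_measure_ne_zero h0'
  have hi : IntegrableOn u B := by
    obtain ⟨y, hy⟩ := hne
    exact integrableOn_L2 u fun x hx => Domain.visible_left (hv x hx y hy)
  rw [← average_sub_const h0 h1 hi]
  refine (enorm_average_sq_le h0 h1 (hi.sub
    (integrableOn_const h1 : IntegrableOn (fun _ => ⨍ y in B', u y) B)).aestronglyMeasurable).trans ?_
  rw [mul_assoc, mul_assoc]
  gcongr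
  calc ∫⁻ x in B, ‖u x - ⨍ y in B', u y‖ₑ ^ 2
      ≤ ∫⁻ x in B, (volume B')⁻¹ * ∫⁻ y, visDiff u x y :=
        setLIntegral_mono' hB fun x hx => enorm_sub_average_sq_le u hB' h0' h1' (hv x hx)
    _ ≤ ∫⁻ x, (volume B')⁻¹ * ∫⁻ y, visDiff u x y := setLIntegral_le_lintegral _ _
    _ = (volume B')⁻¹ * ∫⁻ x, ∫⁻ y, visDiff u x y :=
        lintegral_const_mul _ (measurable_visDiff u).lintegral_prod_right'
    _ ≤ _ := by gcongr; exact hD u q hu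

theorem linked_balls_of_convex {U : Set E3} (hU : Convex ℝ U) (hΩ : U ⊆ Ω.carrier) {x y : E3}
    {r s : ℝ} (hr : 0 < r) (hs : 0 < s) (hx : Metric.ball x r ⊆ U) (hy : Metric.ball y s ⊆ U) :
    Linked Ω (Metric.ball x r) (Metric.ball y s) :=
  linked_of_visible measurableSet_ball measurableSet_ball (Metric.measure_ball_pos _ _ hr).ne'
    measure_ball_lt_top.ne (Metric.measure_ball_pos _ _ hs).ne' measure_ball_lt_top.ne
    fun _ ha _ hb => Domain.visible_of_convex hU hΩ (hx ha) (hy hb)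

/-- Any two balls in the connected set `Ω` are linked. -/
theorem linked_balls {x y : E3} {r s : ℝ} (hr : 0 < r) (hs : 0 < s)
    (hx : Metric.ball x r ⊆ Ω.carrier) (hy : Metric.ball y s ⊆ Ω.carrier) :
    Linked Ω (Metric.ball x r) (Metric.ball y s) := by
  -- All radii are quantified inside the relation, so that it is transitive through any small ball
  -- about the middle point.
  let P : E3 → E3 → Prop := fun x y => ∀ r s : ℝ, 0 < r → 0 < s → Metric.ball x r ⊆ Ω.carrier →
    Metric.ball y s ⊆ Ω.carrier → Linked Ω (Metric.ball x r) (Metric.ball y s)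
  suffices h : P x y from h r s hr hs hx hy
  have hexists : ∀ z ∈ Ω.carrier, ∃ R > 0, Metric.ball z R ⊆ Ω.carrier := fun z hz =>
    Metric.isOpen_iff.1 Ω.isOpen z hz
  refine Ω.isConnected.isPreconnected.induction₂' P (fun z hz => ?_) ?_
    (hx (Metric.mem_ball_self hr)) (hy (Metric.mem_ball_self hs))
  · obtain ⟨R, hR, hzR⟩ := hexists z hz
    filter_upwards [mem_nhdsWithin_of_mem_nhds (Metric.ball_mem_nhds z hR)] with y hy
    have key : P z y := by
      intro r s hr hs hzr hys
      obtain ⟨δ, hδ, hyδ⟩ := Metric.isOpen_iff.1 Metric.isOpen_ball y hy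
      -- The ball about `y` of radius `min δ s` is the intermediate link: it lies in a convex ball
      -- about `z` inside `Ω` and also in the given ball about `y`.
      have hyδ' : Metric.ball y (min δ s) ⊆ Metric.ball z R :=
        (Metric.ball_subset_ball (min_le_left _ _)).trans hyδ
      have hmax : Metric.ball z (max r R) ⊆ Ω.carrier := by
        rcases max_choice r R with h | h <;> rw [h] <;> assumption
      have l1 : Linked Ω (Metric.ball z r) (Metric.ball y (min δ s)) :=
        linked_balls_of_convex (convex_ball z _) hmax hr (lt_min hδ hs)
          (Metric.ball_subset_ball (le_max_left _ _))
          (hyδ'.trans (Metric.ball_subset_ball (le_max_right _ _)))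
      exact l1.trans (linked_balls_of_convex (convex_ball y s) hys (lt_min hδ hs) hs
        (Metric.ball_subset_ball (min_le_right _ _)) subset_rfl)
    exact ⟨key, fun r s hr hs h1 h2 => (key s r hs hr h2 h1).symm⟩
  · intro a b c ha hb hc hab hbc r s hr hs h1 h2
    obtain ⟨R, hR, hbR⟩ := hexists b hb
    exact (hab r R hr hR h1 hbR).trans (hbc R s hR hs hbR h2)

/-! ### The cone property -/

/-- A ball around the axis point at distance `ρ / 2` fits into the cone at `x`, with a radius
depending only on the cone; the cone is star-shaped about its vertex, so `x` sees all of it. -/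
theorem Domain.exists_visible_ball (Ω : Domain) :
    ∃ r > 0, ∀ x ∈ Ω.carrier, ∃ c, ∀ y ∈ Metric.ball c r, (x, y) ∈ Ω.visible := by
  obtain ⟨ρ, hρ, s, hs0, hs1, h⟩ := Ω.cone
  have h1s : 0 < 1 - s := by linarith
  -- If `e` is the deviation from the axis point, the angle condition follows from `s * (ρ / 2) +
  -- ‖e‖ < ρ / 2 - ‖e‖`, that is `‖e‖ < (1 - s) * ρ / 4`.
  refine ⟨(1 - s) * ρ / 4, by positivity, fun x hx => ?_⟩
  obtain ⟨ξ, hξ, hcone⟩ := h x hx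
  refine ⟨x + (ρ / 2) • ξ, fun y hy => ?_⟩
  set v : E3 := y - x
  have he : ‖v - (ρ / 2) • ξ‖ < (1 - s) * ρ / 4 := by
    rw [mem_ball_iff_norm] at hy
    rwa [sub_sub]
  have hn : ‖(ρ / 2) • ξ‖ = ρ / 2 := by
    rw [norm_smul, hξ, Real.norm_of_nonneg (by positivity), mul_one]
  have hv : ‖v‖ ≤ ρ / 2 + ‖v - (ρ / 2) • ξ‖ := by
    calc ‖v‖ = ‖(ρ / 2) • ξ + (v - (ρ / 2) • ξ)‖ := by rw [add_sub_cancel]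
      _ ≤ ‖(ρ / 2) • ξ‖ + _ := norm_add_le _ _
      _ = _ := by rw [hn]
  have hip : ρ / 2 - ‖v - (ρ / 2) • ξ‖ ≤ ⟪ξ, v⟫ := by
    have e : ⟪ξ, v⟫ = ρ / 2 + ⟪ξ, v - (ρ / 2) • ξ⟫ := by
      rw [inner_sub_right ξ v, inner_smul_right, real_inner_self_eq_norm_sq, hξ]; ring
    have := abs_le.1 (abs_real_inner_le_norm ξ (v - (ρ / 2) • ξ))
    rw [hξ, one_mul] at this
    linarith [this.1]
  have hvρ : ‖v‖ < ρ := by nlinarith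
  have hvs : s * ‖v‖ < ⟪ξ, v⟫ := by
    have h1 := mul_le_mul_of_nonneg_left hv hs0.le
    have h2 := mul_le_of_le_one_left (norm_nonneg (v - (ρ / 2) • ξ)) hs1.le
    nlinarith
  intro t ht
  rcases ht.1.eq_or_lt with h0 | h0
  · simpa [← h0] using hx
  · refine hcone _ ?_ ?_
    · rw [norm_smul, Real.norm_of_nonneg h0.le]
      exact (mul_le_of_le_one_left (norm_nonneg v) ht.2).trans_lt hvρ
    · rw [norm_smul, Real.norm_of_nonneg h0.le, inner_smul_right]
      calc s * (t * ‖v‖) = t * (s * ‖v‖) := by ring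
        _ < _ := mul_lt_mul_of_pos_left hvs h0

/-- Total boundedness of `Ω` supplies a finite `r / 2`-net; moving a centre to the net and halving
the radius keeps the ball inside the visible one. -/
theorem Domain.exists_finset_visible_ball (Ω : Domain) :
    ∃ r > 0, ∃ t : Finset E3, (∀ c ∈ t, Metric.ball c r ⊆ Ω.carrier) ∧
      ∀ x ∈ Ω.carrier, ∃ c ∈ t, ∀ y ∈ Metric.ball c r, (x, y) ∈ Ω.visible := by
  classical
  obtain ⟨r, hr, h⟩ := Ω.exists_visible_ball
  have htb : TotallyBounded Ω.carrier := 
    Ω.isBounded.isCompact_closure.totallyBounded.subset subset_closure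
  obtain ⟨t, ht, hcov⟩ := Metric.totallyBounded_iff.1 htb (r / 2) (by positivity)
  refine ⟨r / 2, by positivity, {c ∈ ht.toFinset | Metric.ball c (r / 2) ⊆ Ω.carrier},
    fun c hc => (Finset.mem_filter.1 hc).2, fun x hx => ?_⟩
  obtain ⟨c, hc⟩ := h x hx
  have hcΩ : c ∈ Ω.carrier := Domain.visible_right (hc c (Metric.mem_ball_self hr))
  obtain ⟨c', hc', hcc'⟩ := mem_iUnion₂.1 (hcov hcΩ)
  have hsub : Metric.ball c' (r / 2) ⊆ Metric.ball c r := by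
    refine Metric.ball_subset_ball' ?_
    rw [Metric.mem_ball, dist_comm] at hcc'
    linarith
  refine ⟨c', Finset.mem_filter.2 ⟨by simpa using hc', fun y hy => ?_⟩, fun y hy => hc y (hsub hy)⟩
  exact Domain.visible_right (hc y (hsub hy))

/-! ### The Poincaré inequality -/

theorem chi_coeFn (Ω : Domain) : chi Ω =ᵐ[Ω.vol] fun _ => (1 : ℝ) := Lp.coeFn_const ..

theorem inner_chi (u : L2 Ω) : ⟪chi Ω, u⟫ = ∫ x in Ω.carrier, u x := by
  rw [L2.inner_def]
  refine integral_congr_ae ?_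
  filter_upwards [chi_coeFn Ω] with x hx
  rw [hx]; simp

theorem norm_chi_pos (Ω : Domain) : 0 < ‖chi Ω‖ := by
  rw [norm_pos_iff]
  intro h
  have h1 := inner_chi (chi Ω)
  rw [integral_congr_ae (chi_coeFn Ω), h] at h1
  have h2 : 0 < volume Ω.carrier := Ω.isOpen.measure_pos _ Ω.isConnected.nonempty
  have h3 : 0 < volume.real Ω.carrier :=
    ENNReal.toReal_pos h2.ne' Ω.isBounded.measure_lt_top.ne
  rw [inner_zero_left, integral_const, smul_eq_mul, mul_one, measureReal_restrict_apply_univ] at h1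
  exact h3.ne h1

/-- The constant `m` is the mean over one reference ball. The value `u x` is compared with the mean
over a ball that `x` sees, and that mean with `m` through the link between the two balls. -/
theorem exists_norm_sub_smul_chi_le (Ω : Domain) :
    ∃ C : ℝ, 0 ≤ C ∧ ∀ (u : L2 Ω) (q : L2vec Ω), IsWeakGradient Ω u q →
      ∃ m : ℝ, ‖u - m • chi Ω‖ ≤ C * ‖q‖ := by
  obtain ⟨r, hr, t, htΩ, ht⟩ := Ω.exists_finset_visible_ball
  obtain ⟨x₀, hx₀⟩ := Ω.isConnected.nonempty
  obtain ⟨c₀, hc₀, -⟩ := ht x₀ hx₀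
  obtain ⟨C, hC, hD⟩ := exists_lintegral_visDiff_le Ω
  have hlink : ∀ c : E3, ∃ M : ℝ, 0 ≤ M ∧ (c ∈ t → ∀ (u : L2 Ω) (q : L2vec Ω),
      IsWeakGradient Ω u q →
        ‖(⨍ y in Metric.ball c r, u y) - ⨍ y in Metric.ball c₀ r, u y‖ ≤ M * ‖q‖) := by
    intro c
    by_cases hc : c ∈ t
    · obtain ⟨M, h0, h⟩ := linked_balls hr hr (htΩ c hc) (htΩ c₀ hc₀)
      exact ⟨M, h0, fun _ => h⟩
    · exact ⟨0, le_rfl, fun h => absurd h hc⟩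
  choose M hM0 hM using hlink
  -- The sum is a common upper bound for the finitely many link constants.
  set N : ℝ := ∑ c ∈ t, M c
  have hN0 : 0 ≤ N := Finset.sum_nonneg fun c _ => hM0 c
  set v : ENNReal := volume (Metric.ball (0 : E3) r)
  have hv0 : v ≠ 0 := (Metric.measure_ball_pos _ _ hr).ne'
  have hvt : v ≠ ⊤ := measure_ball_lt_top.ne
  have hvc : ∀ c : E3, volume (Metric.ball c r) = v := fun c =>
    Measure.addHaar_ball_center volume c r
  have hK : 2 * (v⁻¹ * C + ENNReal.ofReal N ^ 2 * volume Ω.carrier) ≠ ⊤ :=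
    ENNReal.mul_ne_top (by simp) (ENNReal.add_ne_top.2 ⟨ENNReal.mul_ne_top (by simp [hv0]) hC,
      ENNReal.mul_ne_top (by simp) Ω.isBounded.measure_lt_top.ne⟩)
  refine ⟨_, Real.sqrt_nonneg _, fun u q hu => ⟨⨍ y in Metric.ball c₀ r, u y,
    norm_le_sqrt_mul_of_enorm_sq_le hK ?_⟩⟩
  set m := ⨍ y in Metric.ball c₀ r, u y
  have hpt : ∀ x ∈ Ω.carrier, ‖u x - m‖ₑ ^ 2
      ≤ 2 * (v⁻¹ * (∫⁻ y, visDiff u x y) + (ENNReal.ofReal N * ‖q‖ₑ) ^ 2) := by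
    intro x hx
    obtain ⟨c, hc, hvis⟩ := ht x hx
    set mc := ⨍ y in Metric.ball c r, u y
    have h1 : ‖u x - mc‖ₑ ^ 2 ≤ v⁻¹ * ∫⁻ y, visDiff u x y := by
      rw [← hvc c]
      exact enorm_sub_average_sq_le u measurableSet_ball (by rw [hvc]; exact hv0)
        (by rw [hvc]; exact hvt) hvis
    have h2 : ‖mc - m‖ₑ ≤ ENNReal.ofReal N * ‖q‖ₑ := by
      rw [← ofReal_norm, ← ofReal_norm, ← ENNReal.ofReal_mul hN0]
      refine ENNReal.ofReal_le_ofReal ((hM c hc u q hu).trans ?_)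
      gcongr
      exact Finset.single_le_sum (fun c _ => hM0 c) hc
    calc ‖u x - m‖ₑ ^ 2 ≤ (‖u x - mc‖ₑ + ‖mc - m‖ₑ) ^ 2 := by
          gcongr
          calc ‖u x - m‖ₑ = ‖(u x - mc) + (mc - m)‖ₑ := by congr 1; ring
            _ ≤ _ := enorm_add_le _ _
      _ ≤ 2 * (‖u x - mc‖ₑ ^ 2 + ‖mc - m‖ₑ ^ 2) := by
          have := ENNReal.rpow_add_le_mul_rpow_add_rpow ‖u x - mc‖ₑ ‖mc - m‖ₑ
            (p := 2) (by norm_num)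
          norm_num at this
          exact this
      _ ≤ _ := by gcongr
  have hco : (u - m • chi Ω : L2 Ω) =ᵐ[Ω.vol] fun x => u x - m := by
    filter_upwards [Lp.coeFn_sub u (m • chi Ω), Lp.coeFn_smul m (chi Ω), chi_coeFn Ω]
      with x h1 h2 h3
    rw [h1, Pi.sub_apply, h2, Pi.smul_apply, h3]; simp
  have hmeas : Measurable fun x => ∫⁻ y, visDiff u x y :=
    (measurable_visDiff u).lintegral_prod_right'
  calc ‖u - m • chi Ω‖ₑ ^ 2 = ∫⁻ x in Ω.carrier, ‖u x - m‖ₑ ^ 2 := by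
        rw [Lp.enorm_def, eLpNorm_congr_ae hco, sq_eLpNorm_two]
    _ ≤ ∫⁻ x in Ω.carrier,
          2 * (v⁻¹ * (∫⁻ y, visDiff u x y) + (ENNReal.ofReal N * ‖q‖ₑ) ^ 2) :=
        setLIntegral_mono' Ω.isOpen.measurableSet hpt
    _ = 2 * (v⁻¹ * (∫⁻ x in Ω.carrier, ∫⁻ y, visDiff u x y)
          + (ENNReal.ofReal N * ‖q‖ₑ) ^ 2 * volume Ω.carrier) := by
        rw [lintegral_const_mul _ (by fun_prop), lintegral_add_right _ measurable_const,
          lintegral_const_mul _ hmeas, setLIntegral_const]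
    _ ≤ 2 * (v⁻¹ * (C * ‖q‖ₑ ^ 2) + (ENNReal.ofReal N * ‖q‖ₑ) ^ 2 * volume Ω.carrier) := by
        gcongr
        exact (setLIntegral_le_lintegral _ _).trans (hD u q hu)
    _ = _ := by ring

/-- The Poincaré inequality on a bounded connected open set with the cone property. -/
theorem exists_poincare (Ω : Domain) :
    ∃ C : ℝ, 0 < C ∧ ∀ (u : L2 Ω) (q : L2vec Ω), IsWeakGradient Ω u q →
      ‖u‖ ≤ C * (‖q‖ + |∫ x in Ω.carrier, u x|) := by
  obtain ⟨C, hC0, hC⟩ := exists_norm_sub_smul_chi_le Ω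
  have hchi := norm_chi_pos Ω
  refine ⟨2 * C + ‖chi Ω‖⁻¹, by positivity, fun u q hu => ?_⟩
  obtain ⟨m, hm⟩ := hC u q hu
  rw [← inner_chi]
  set c := chi Ω
  -- Pairing `u = (u - m • c) + m • c` with `c` bounds the unknown constant `m` by the integral of
  -- `u` and the oscillation.
  have e : m * ‖c‖ ^ 2 = ⟪c, u⟫ - ⟪c, u - m • c⟫ := by
    rw [inner_sub_right, inner_smul_right, real_inner_self_eq_norm_sq]; ring
  have h1 : |m| * ‖c‖ ^ 2 ≤ |⟪c, u⟫| + ‖c‖ * ‖u - m • c‖ := by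
    calc |m| * ‖c‖ ^ 2 = |m * ‖c‖ ^ 2| := by rw [abs_mul, abs_of_nonneg (sq_nonneg ‖c‖)]
      _ ≤ |⟪c, u⟫| + |⟪c, u - m • c⟫| := by rw [e]; exact abs_sub _ _
      _ ≤ _ := by gcongr; exact abs_real_inner_le_norm _ _
  have h2 : ‖m • c‖ ≤ ‖c‖⁻¹ * |⟪c, u⟫| + ‖u - m • c‖ := by
    rw [norm_smul, Real.norm_eq_abs]
    calc |m| * ‖c‖ = ‖c‖⁻¹ * (|m| * ‖c‖ ^ 2) := by field_simp
      _ ≤ ‖c‖⁻¹ * (|⟪c, u⟫| + ‖c‖ * ‖u - m • c‖) := by gcongr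
      _ = _ := by field_simp
  have h3 : ‖u‖ ≤ ‖u - m • c‖ + ‖m • c‖ := by
    calc ‖u‖ = ‖(u - m • c) + m • c‖ := by rw [sub_add_cancel]
      _ ≤ _ := norm_add_le _ _
  have h4 : 0 ≤ ‖c‖⁻¹ * ‖q‖ := by positivity
  have h5 : 0 ≤ C * |⟪c, u⟫| := by positivity
  nlinarith

/-! ### The Huber function -/

section Huber

variable {γ : ℝ}

/-- The gradient of `v ↦ H_γ(‖v‖)`. -/
noncomputable def huberGrad (γ : ℝ) (v : E3) : E3 := (max γ ‖v‖)⁻¹ • v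

theorem huberGrad_of_le {v : E3} (h : γ ≤ ‖v‖) : huberGrad γ v = ‖v‖⁻¹ • v := by
  rw [huberGrad, max_eq_right h]

theorem huberGrad_of_ge {v : E3} (h : ‖v‖ ≤ γ) : huberGrad γ v = γ⁻¹ • v := by
  rw [huberGrad, max_eq_left h]

theorem huber_norm_of_le {v : E3} (h : γ ≤ ‖v‖) : huber γ ‖v‖ = ‖v‖ - γ / 2 := by
  rw [huber, abs_of_nonneg (norm_nonneg v), if_pos h]

theorem huber_norm_of_lt {v : E3} (h : ‖v‖ < γ) : huber γ ‖v‖ = 1 / (2 * γ) * ‖v‖ ^ 2 := by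
  rw [huber, abs_of_nonneg (norm_nonneg v), if_neg h.not_ge]

theorem norm_huberGrad_le_one (hγ : 0 < γ) (v : E3) : ‖huberGrad γ v‖ ≤ 1 := by
  have hm : 0 < max γ ‖v‖ := lt_max_of_lt_left hγ
  rw [huberGrad, norm_smul, norm_inv, Real.norm_of_nonneg hm.le, inv_mul_le_one₀ hm]
  exact le_max_right _ _

/-- Fenchel–Young inequality: the conjugate of `v ↦ H_γ(‖v‖)` is `γ / 2 * ‖p‖ ^ 2` on the unit ball.
Equality at `p = huberGrad γ v` is `inner_huberGrad_sub`. -/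
theorem inner_sub_le_huber (hγ : 0 < γ) {p : E3} (hp : ‖p‖ ≤ 1) (v : E3) :
    ⟪p, v⟫ - γ / 2 * ‖p‖ ^ 2 ≤ huber γ ‖v‖ := by
  have h1 : ⟪p, v⟫ ≤ ‖p‖ * ‖v‖ := real_inner_le_norm p v
  have h0 := norm_nonneg p
  rcases le_or_gt γ ‖v‖ with h | h
  · rw [huber_norm_of_le h]
    nlinarith [mul_nonneg (sub_nonneg.2 hp) (sub_nonneg.2 h),
      mul_nonneg (mul_nonneg (sub_nonneg.2 hp) (sub_nonneg.2 hp)) hγ.le]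
  · rw [huber_norm_of_lt h]
    have : 1 / (2 * γ) * ‖v‖ ^ 2 - (‖p‖ * ‖v‖ - γ / 2 * ‖p‖ ^ 2)
        = 1 / (2 * γ) * (‖v‖ - γ * ‖p‖) ^ 2 := by field_simp; ring
    have h2 : 0 ≤ 1 / (2 * γ) * (‖v‖ - γ * ‖p‖) ^ 2 := by positivity
    linarith

theorem inner_huberGrad_sub (hγ : 0 < γ) (v : E3) :
    ⟪huberGrad γ v, v⟫ - γ / 2 * ‖huberGrad γ v‖ ^ 2 = huber γ ‖v‖ := by
  rcases le_or_gt γ ‖v‖ with h | h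
  · have hv : 0 < ‖v‖ := hγ.trans_le h
    rw [huber_norm_of_le h, huberGrad_of_le h, real_inner_smul_left, real_inner_self_eq_norm_sq,
      norm_smul, norm_inv, norm_norm]
    field_simp
  · rw [huber_norm_of_lt h, huberGrad_of_ge h.le, real_inner_smul_left,
      real_inner_self_eq_norm_sq, norm_smul, norm_inv, Real.norm_of_nonneg hγ.le]
    field_simp; ring

/-- The Huber function is the Moreau envelope of the norm, so every `z` gives an upper bound. The
optimal `z = v - γ • huberGrad γ v` is treated in `norm_sub_smul_huberGrad`. -/
theorem huber_le_norm_add (hγ : 0 < γ) (v z : E3) :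
    huber γ ‖v‖ ≤ ‖z‖ + 1 / (2 * γ) * ‖v - z‖ ^ 2 := by
  have h1 : ‖v‖ ≤ ‖z‖ + ‖v - z‖ := by
    calc ‖v‖ = ‖z + (v - z)‖ := by rw [add_sub_cancel]
      _ ≤ _ := norm_add_le _ _
  have ha := norm_nonneg z
  have hb := norm_nonneg (v - z)
  have hv := norm_nonneg v
  have hc : 0 < 1 / (2 * γ) := by positivity
  have hcγ : 1 / (2 * γ) * (2 * γ) = 1 := by field_simp
  rcases le_or_gt γ ‖v‖ with h | h
  · rw [huber_norm_of_le h]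
    have : ‖v - z‖ - γ / 2 ≤ 1 / (2 * γ) * ‖v - z‖ ^ 2 := by
      have e : 1 / (2 * γ) * ‖v - z‖ ^ 2 - (‖v - z‖ - γ / 2)
          = 1 / (2 * γ) * (‖v - z‖ - γ) ^ 2 := by field_simp; ring
      have : 0 ≤ 1 / (2 * γ) * (‖v - z‖ - γ) ^ 2 := by positivity
      linarith
    linarith
  · rw [huber_norm_of_lt h]
    -- If `‖v - z‖ < ‖v‖ < γ`, factor the difference of squares: one factor is at most `‖z‖`, the
    -- other at most `2 * γ`.
    have h2 : ‖v‖ ^ 2 ≤ (2 * γ) * ‖z‖ + ‖v - z‖ ^ 2 := by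
      rcases le_or_gt ‖v‖ ‖v - z‖ with h3 | h3 <;> nlinarith
    calc 1 / (2 * γ) * ‖v‖ ^ 2 ≤ 1 / (2 * γ) * ((2 * γ) * ‖z‖ + ‖v - z‖ ^ 2) := by gcongr
      _ = _ := by rw [mul_add, ← mul_assoc, hcγ, one_mul]

theorem norm_sub_smul_huberGrad (hγ : 0 < γ) (v : E3) :
    ‖v - γ • huberGrad γ v‖ + γ / 2 * ‖huberGrad γ v‖ ^ 2 = huber γ ‖v‖ := by
  rcases le_or_gt γ ‖v‖ with h | h
  · have hv : 0 < ‖v‖ := hγ.trans_le h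
    have e : v - γ • huberGrad γ v = (1 - γ * ‖v‖⁻¹) • v := by
      rw [huberGrad_of_le h, sub_smul, one_smul, mul_smul]
    have h1 : γ * ‖v‖⁻¹ ≤ 1 := by rw [← div_eq_mul_inv]; exact (div_le_one hv).2 h
    rw [e, huber_norm_of_le h, huberGrad_of_le h, norm_smul, norm_smul, norm_inv, norm_norm,
      Real.norm_of_nonneg (sub_nonneg.2 h1)]
    field_simp; ring
  · have e : v - γ • huberGrad γ v = 0 := by
      rw [huberGrad_of_ge h.le, smul_smul, mul_inv_cancel₀ hγ.ne', one_smul, sub_self]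
    rw [e, huber_norm_of_lt h, huberGrad_of_ge h.le, norm_smul, norm_inv,
      Real.norm_of_nonneg hγ.le]
    simp; field_simp

theorem huber_nonneg (hγ : 0 < γ) (v : E3) : 0 ≤ huber γ ‖v‖ := by
  simpa using inner_sub_le_huber hγ (p := 0) (by simp) v

theorem huber_le_sq (hγ : 0 < γ) (v : E3) : huber γ ‖v‖ ≤ 1 / (2 * γ) * ‖v‖ ^ 2 := by
  simpa using huber_le_norm_add hγ v 0

/-- The maximiser in the dual formula at `v` is a competitor at `v + ξ`. -/
theorem huber_add_ge (hγ : 0 < γ) (v ξ : E3) :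
    huber γ ‖v‖ + ⟪huberGrad γ v, ξ⟫ ≤ huber γ ‖v + ξ‖ := by
  have := inner_sub_le_huber hγ (norm_huberGrad_le_one hγ v) (v + ξ)
  rw [inner_add_right] at this
  linarith [inner_huberGrad_sub hγ v]

/-- The minimiser in the Moreau envelope at `v` is a competitor at `v + ξ`; expanding the square
gives the first-order term. -/
theorem huber_add_le (hγ : 0 < γ) (v ξ : E3) :
    huber γ ‖v + ξ‖ ≤ huber γ ‖v‖ + ⟪huberGrad γ v, ξ⟫ + 1 / (2 * γ) * ‖ξ‖ ^ 2 := by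
  have h1 := huber_le_norm_add hγ (v + ξ) (v - γ • huberGrad γ v)
  have e : v + ξ - (v - γ • huberGrad γ v) = γ • huberGrad γ v + ξ := by abel
  rw [e, norm_add_sq_real, norm_smul, Real.norm_of_nonneg hγ.le, real_inner_smul_left] at h1
  have e2 : 1 / (2 * γ) * ((γ * ‖huberGrad γ v‖) ^ 2 + 2 * (γ * ⟪huberGrad γ v, ξ⟫) + ‖ξ‖ ^ 2)
      = γ / 2 * ‖huberGrad γ v‖ ^ 2 + ⟪huberGrad γ v, ξ⟫ + 1 / (2 * γ) * ‖ξ‖ ^ 2 := by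
    field_simp
  rw [e2] at h1
  linarith [norm_sub_smul_huberGrad hγ v]

/-- Compare the scalar factors and the vectors separately. The sharp constant would be `1 / γ`, but
any constant will do. -/
theorem lipschitzWith_huberGrad (hγ : 0 < γ) :
    LipschitzWith (2 / γ).toNNReal (huberGrad γ) := by
  refine LipschitzWith.of_dist_le_mul fun v w => ?_
  rw [Real.coe_toNNReal _ (by positivity), dist_eq_norm, dist_eq_norm, huberGrad, huberGrad]
  set a := max γ ‖v‖
  set b := max γ ‖w‖
  have ha : γ ≤ a := le_max_left _ _
  have hb : γ ≤ b := le_max_left _ _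
  have ha0 : 0 < a := hγ.trans_le ha
  have hb0 : 0 < b := hγ.trans_le hb
  have hwb : ‖w‖ ≤ b := le_max_right _ _
  have hab : |b - a| ≤ ‖v - w‖ := by
    have h := abs_max_sub_max_le_abs ‖w‖ ‖v‖ γ
    rw [max_comm ‖w‖, max_comm ‖v‖, abs_sub_comm ‖w‖] at h
    refine h.trans ?_
    exact abs_norm_sub_norm_le v w
  have e : a⁻¹ • v - b⁻¹ • w = a⁻¹ • (v - w) + ((b - a) * (a⁻¹ * b⁻¹)) • w := by
    have : (b - a) * (a⁻¹ * b⁻¹) = a⁻¹ - b⁻¹ := by field_simp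
    rw [this, smul_sub, sub_smul]; abel
  rw [e]
  refine (norm_add_le _ _).trans ?_
  rw [norm_smul, norm_smul, norm_mul, norm_mul, norm_inv, norm_inv,
    Real.norm_of_nonneg ha0.le, Real.norm_of_nonneg hb0.le, Real.norm_eq_abs]
  have h1 : a⁻¹ ≤ γ⁻¹ := inv_anti₀ hγ ha
  have h2 : b⁻¹ * ‖w‖ ≤ 1 := by rw [inv_mul_le_one₀ hb0]; exact hwb
  calc a⁻¹ * ‖v - w‖ + |b - a| * (a⁻¹ * b⁻¹) * ‖w‖
      = a⁻¹ * ‖v - w‖ + |b - a| * a⁻¹ * (b⁻¹ * ‖w‖) := by ring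
    _ ≤ γ⁻¹ * ‖v - w‖ + ‖v - w‖ * γ⁻¹ * 1 := by gcongr
    _ = 2 / γ * ‖v - w‖ := by ring

theorem huberGrad_zero (γ : ℝ) : huberGrad γ 0 = 0 := by simp [huberGrad]

theorem differentiableAt_huberGrad (hγ : 0 < γ) {v : E3} (hv : ‖v‖ ≠ γ) :
    DifferentiableAt ℝ (huberGrad γ) v := by
  rcases hv.lt_or_gt with h | h
  · have : huberGrad γ =ᶠ[𝓝 v] fun w => γ⁻¹ • w := by
      filter_upwards [continuous_norm.continuousAt.eventually_lt_const h] with w hw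
      exact huberGrad_of_ge hw.le
    exact (by fun_prop : DifferentiableAt ℝ (fun w : E3 => γ⁻¹ • w) v).congr_of_eventuallyEq this
  · have : huberGrad γ =ᶠ[𝓝 v] fun w => ‖w‖⁻¹ • w := by
      filter_upwards [continuous_norm.continuousAt.eventually_const_lt h] with w hw
      exact huberGrad_of_le hw.le
    have hv0 : v ≠ 0 := by
      rintro rfl
      rw [norm_zero] at h
      exact hγ.not_gt h
    exact (((differentiableAt_id.norm ℝ hv0).inv (norm_ne_zero_iff.2 hv0)).smul
      differentiableAt_id).congr_of_eventuallyEq this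

theorem measurable_huber (γ : ℝ) : Measurable (huber γ) :=
  Measurable.ite (measurableSet_le measurable_const (by fun_prop)) (by fun_prop) (by fun_prop)

end Huber

/-! ### The functional `Θ` and its gradient -/

variable {γ : ℝ}

/-- The gradient of `Θ`: the superposition operator of `huberGrad` plus `ε` times the identity. -/
noncomputable def gradTheta (Ω : Domain) (hγ : 0 < γ) (ε : ℝ) (v : L2vec Ω) : L2vec Ω :=
  (lipschitzWith_huberGrad hγ).compLp (huberGrad_zero γ) v + ε • v

theorem integrable_huber (hγ : 0 < γ) (v : L2vec Ω) :
    Integrable (fun x => huber γ ‖v x‖) Ω.vol := by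
  refine (((Lp.memLp v).integrable_norm_pow (by norm_num)).const_mul (1 / (2 * γ))).mono'
    (((measurable_huber γ).comp_aemeasurable
      (Lp.aestronglyMeasurable v).norm.aemeasurable).aestronglyMeasurable)
    (Eventually.of_forall fun x => ?_)
  rw [Real.norm_of_nonneg (huber_nonneg hγ _)]
  exact huber_le_sq hγ _

theorem integrable_inner_L2vec (p q : L2vec Ω) : Integrable (fun x => ⟪p x, q x⟫) Ω.vol :=
  L2.integrable_inner p q

theorem norm_sq_L2vec (q : L2vec Ω) : ‖q‖ ^ 2 = ∫ x in Ω.carrier, ‖q x‖ ^ 2 := by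
  rw [← real_inner_self_eq_norm_sq, L2.inner_def]
  simp_rw [real_inner_self_eq_norm_sq]

theorem Theta_nonneg (hγ : 0 < γ) {ε : ℝ} (hε : 0 ≤ ε) (v : L2vec Ω) : 0 ≤ Theta Ω γ ε v :=
  add_nonneg (integral_nonneg fun x => huber_nonneg hγ _) (by positivity)

/-- The pointwise Huber bounds are integrated, and the `ε`-term is expanded exactly. The lower bound
yields strong convexity, the upper one Fréchet differentiability. -/
theorem Theta_add_sub (hγ : 0 < γ) (ε : ℝ) (v ξ : L2vec Ω) :
    ε / 2 * ‖ξ‖ ^ 2 ≤ Theta Ω γ ε (v + ξ) - Theta Ω γ ε v - ⟪gradTheta Ω hγ ε v, ξ⟫ ∧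
    Theta Ω γ ε (v + ξ) - Theta Ω γ ε v - ⟪gradTheta Ω hγ ε v, ξ⟫
      ≤ (1 / (2 * γ) + ε / 2) * ‖ξ‖ ^ 2 := by
  set p := (lipschitzWith_huberGrad hγ).compLp (huberGrad_zero γ) v
  have hp : p =ᵐ[Ω.vol] fun x => huberGrad γ (v x) := LipschitzWith.coeFn_compLp _ _ _
  have hadd := Lp.coeFn_add v ξ
  have e1 : ∫ x in Ω.carrier, huber γ ‖(v + ξ) x‖ = ∫ x in Ω.carrier, huber γ ‖v x + ξ x‖ :=
    integral_congr_ae (by filter_upwards [hadd] with x hx; rw [hx, Pi.add_apply])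
  have i1 : Integrable (fun x => huber γ ‖v x + ξ x‖) Ω.vol :=
    (integrable_huber hγ (v + ξ)).congr (by
      filter_upwards [hadd] with x hx; rw [hx, Pi.add_apply])
  have e2 : ⟪p, ξ⟫ = ∫ x in Ω.carrier, ⟪huberGrad γ (v x), ξ x⟫ := by
    rw [L2.inner_def]
    exact integral_congr_ae (by filter_upwards [hp] with x hx; rw [hx])
  have i2 : Integrable (fun x => ⟪huberGrad γ (v x), ξ x⟫) Ω.vol :=
    (integrable_inner_L2vec p ξ).congr (by filter_upwards [hp] with x hx; rw [hx])
  have i3 : Integrable (fun x => ‖ξ x‖ ^ 2) Ω.vol := (Lp.memLp ξ).integrable_norm_pow (by norm_num)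
  have key : Theta Ω γ ε (v + ξ) - Theta Ω γ ε v - ⟪gradTheta Ω hγ ε v, ξ⟫
      = (∫ x in Ω.carrier, (huber γ ‖v x + ξ x‖ - huber γ ‖v x‖ - ⟪huberGrad γ (v x), ξ x⟫))
        + ε / 2 * ‖ξ‖ ^ 2 := by
    have i4 : Integrable (fun x => huber γ ‖v x + ξ x‖ - huber γ ‖v x‖) Ω.vol :=
      i1.sub (integrable_huber hγ v)
    rw [integral_sub i4 i2, integral_sub i1 (integrable_huber hγ v),
      ← e2, ← e1, gradTheta, inner_add_left, real_inner_smul_left, Theta, Theta, norm_add_sq_real]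
    ring
  rw [key]
  constructor
  · have : 0 ≤ ∫ x in Ω.carrier,
        (huber γ ‖v x + ξ x‖ - huber γ ‖v x‖ - ⟪huberGrad γ (v x), ξ x⟫) :=
      integral_nonneg fun x => by
        simp only [Pi.zero_apply]; linarith [huber_add_ge hγ (v x) (ξ x)]
    linarith
  · have : ∫ x in Ω.carrier,
        (huber γ ‖v x + ξ x‖ - huber γ ‖v x‖ - ⟪huberGrad γ (v x), ξ x⟫)
        ≤ ∫ x in Ω.carrier, 1 / (2 * γ) * ‖ξ x‖ ^ 2 :=
      integral_mono ((i1.sub (integrable_huber hγ v)).sub i2) (i3.const_mul _) fun x => by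
        simp only; linarith [huber_add_le hγ (v x) (ξ x)]
    rw [integral_const_mul, ← norm_sq_L2vec] at this
    linarith

theorem hasGradientAt_Theta (hγ : 0 < γ) {ε : ℝ} (hε : 0 ≤ ε) (v : L2vec Ω) :
    HasGradientAt (Theta Ω γ ε) (gradTheta Ω hγ ε v) v := by
  rw [hasGradientAt_iff_hasFDerivAt, hasFDerivAt_iff_isLittleO_nhds_zero]
  have hO : (fun ξ : L2vec Ω => Theta Ω γ ε (v + ξ) - Theta Ω γ ε v
      - (InnerProductSpace.toDual ℝ (L2vec Ω)) (gradTheta Ω hγ ε v) ξ)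
      =O[𝓝 0] fun ξ => ‖ξ‖ ^ 2 := by
    refine Asymptotics.IsBigO.of_bound (1 / (2 * γ) + ε / 2) (Eventually.of_forall fun ξ => ?_)
    rw [InnerProductSpace.toDual_apply_apply]
    obtain ⟨h1, h2⟩ := Theta_add_sub hγ ε v ξ
    have h3 : 0 ≤ ε / 2 * ‖ξ‖ ^ 2 := by positivity
    rw [Real.norm_of_nonneg (h3.trans h1), norm_pow, norm_norm]
    exact h2
  exact hO.trans_isLittleO (Asymptotics.isLittleO_norm_pow_id one_lt_two)

theorem gradient_Theta (hγ : 0 < γ) {ε : ℝ} (hε : 0 ≤ ε) :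
    gradient (Theta Ω γ ε) = gradTheta Ω hγ ε :=
  funext fun v => (hasGradientAt_Theta hγ hε v).gradient

theorem lipschitzWith_gradTheta (hγ : 0 < γ) (ε : ℝ) :
    ∃ K, LipschitzWith K (gradTheta Ω hγ ε) :=
  ⟨_, ((lipschitzWith_huberGrad hγ).lipschitzWith_compLp (huberGrad_zero γ)).add
    (lipschitzWith_smul ε)⟩

/-- Multiplication by a bounded measurable field of operators. -/
theorem exists_multiplication_operator {A : E3 → E3 →L[ℝ] E3} (hA : AEStronglyMeasurable A Ω.vol)
    {C : ℝ} (hAC : ∀ x, ‖A x‖ ≤ C) :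
    ∃ M : L2vec Ω →L[ℝ] L2vec Ω, ∀ ξ, M ξ =ᵐ[Ω.vol] fun x => A x (ξ x) := by
  have hle : ∀ (ξ : L2vec Ω) x, ‖A x (ξ x)‖ ≤ C * ‖ξ x‖ := fun ξ x =>
    ((A x).le_opNorm _).trans (by gcongr; exact hAC x)
  have hm : ∀ ξ : L2vec Ω, MemLp (fun x => A x (ξ x)) 2 Ω.vol := fun ξ =>
    (Lp.memLp ξ).of_le_mul (isBoundedBilinearMap_apply.continuous.comp_aestronglyMeasurable
      (hA.prodMk (Lp.aestronglyMeasurable ξ))) (Eventually.of_forall (hle ξ))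
  let L : L2vec Ω →ₗ[ℝ] L2vec Ω :=
    { toFun := fun ξ => (hm ξ).toLp _
      map_add' := fun ξ η => by
        refine Lp.ext ?_
        filter_upwards [(hm (ξ + η)).coeFn_toLp, (hm ξ).coeFn_toLp, (hm η).coeFn_toLp,
          Lp.coeFn_add ((hm ξ).toLp _) ((hm η).toLp _), Lp.coeFn_add ξ η] with x h1 h2 h3 h4 h5
        rw [h1, h4, Pi.add_apply, h2, h3, h5, Pi.add_apply, map_add]
      map_smul' := fun c ξ => by
        refine Lp.ext ?_
        filter_upwards [(hm (c • ξ)).coeFn_toLp, (hm ξ).coeFn_toLp,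
          Lp.coeFn_smul c ((hm ξ).toLp _), Lp.coeFn_smul c ξ] with x h1 h2 h3 h4
        rw [RingHom.id_apply, h1, h3, Pi.smul_apply, h2, h4, Pi.smul_apply, map_smul] }
  refine ⟨L.mkContinuous C fun ξ => ?_, fun ξ => (hm ξ).coeFn_toLp⟩
  refine Lp.norm_le_mul_norm_of_ae_le_mul ?_
  filter_upwards [(hm ξ).coeFn_toLp] with x hx
  change ‖(hm ξ).toLp _ x‖ ≤ _
  rw [hx]
  exact hle ξ x

/-- Superposition with a Lipschitz map is Gâteaux differentiable in `L²` at every function whose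
values are almost everywhere points of differentiability. -/
theorem exists_hasGateauxDerivAt_compLp {h : E3 → E3} {K : NNReal} (hK : LipschitzWith K h)
    (h0 : h 0 = 0) (v : L2vec Ω) (hv : ∀ᵐ x ∂Ω.vol, DifferentiableAt ℝ h (v x)) :
    ∃ M : L2vec Ω →L[ℝ] L2vec Ω, HasGateauxDerivAt (hK.compLp h0) M v := by
  have hA : AEStronglyMeasurable (fun x => fderiv ℝ h (v x)) Ω.vol :=
    ((measurable_fderiv ℝ h).comp_aemeasurable
      (Lp.aestronglyMeasurable v).aemeasurable).aestronglyMeasurable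
  obtain ⟨M, hM⟩ := exists_multiplication_operator hA
    fun x => norm_fderiv_le_of_lipschitz ℝ hK
  refine ⟨M, fun ξ => ?_⟩
  rw [HasLineDerivAt, hasDerivAt_iff_tendsto_slope_zero, tendsto_iff_norm_sub_tendsto_zero]
  have hco : ∀ t : ℝ, (t⁻¹ • (hK.compLp h0 (v + (0 + t) • ξ) - hK.compLp h0 (v + (0 : ℝ) • ξ))
      - M ξ : L2vec Ω) =ᵐ[Ω.vol]
      fun x => t⁻¹ • (h (v x + t • ξ x) - h (v x)) - fderiv ℝ h (v x) (ξ x) := by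
    intro t
    rw [zero_add, zero_smul, add_zero]
    filter_upwards [Lp.coeFn_sub (t⁻¹ • (hK.compLp h0 (v + t • ξ) - hK.compLp h0 v)) (M ξ),
      Lp.coeFn_smul t⁻¹ (hK.compLp h0 (v + t • ξ) - hK.compLp h0 v),
      Lp.coeFn_sub (hK.compLp h0 (v + t • ξ)) (hK.compLp h0 v), hM ξ,
      hK.coeFn_compLp h0 (v + t • ξ), hK.coeFn_compLp h0 v, Lp.coeFn_add v (t • ξ),
      Lp.coeFn_smul t ξ] with x h1 h2 h3 h4 h5 h6 h7 h8
    rw [h1, Pi.sub_apply, h2, Pi.smul_apply, h3, Pi.sub_apply, h4, h5, h6]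
    simp only [Function.comp_apply]
    rw [h7, Pi.add_apply, h8, Pi.smul_apply]
  -- The Lipschitz constant bounds the difference quotient and the derivative alike, which gives the
  -- square-integrable majorant for dominated convergence.
  have hbound : ∀ t : ℝ, ∀ x, ‖t⁻¹ • (h (v x + t • ξ x) - h (v x)) - fderiv ℝ h (v x) (ξ x)‖
      ≤ 2 * K * ‖ξ x‖ := by
    intro t x
    have h1 : ‖t⁻¹ • (h (v x + t • ξ x) - h (v x))‖ ≤ K * ‖ξ x‖ := by
      rcases eq_or_ne t 0 with rfl | ht
      · simp; positivity
      · rw [norm_smul, norm_inv, inv_mul_le_iff₀ (norm_pos_iff.2 ht)]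
        refine (hK.norm_sub_le _ _).trans_eq ?_
        rw [add_sub_cancel_left, norm_smul]; ring
    have h2 : ‖fderiv ℝ h (v x) (ξ x)‖ ≤ K * ‖ξ x‖ :=
      ((fderiv ℝ h (v x)).le_opNorm _).trans (by
        gcongr; exact norm_fderiv_le_of_lipschitz ℝ hK)
    refine (norm_sub_le _ _).trans ?_
    linarith
  have hlim : Tendsto (fun t : ℝ => ∫ x in Ω.carrier,
      ‖t⁻¹ • (h (v x + t • ξ x) - h (v x)) - fderiv ℝ h (v x) (ξ x)‖ ^ 2) (𝓝[≠] 0)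
      (𝓝 (∫ x in Ω.carrier, (0 : ℝ))) := by
    refine tendsto_integral_filter_of_dominated_convergence
      (fun x => (2 * K * ‖ξ x‖) ^ 2) ?_ ?_ ?_ ?_
    · refine Eventually.of_forall fun t => ?_
      exact (((Lp.aestronglyMeasurable _).congr (hco t)).norm.pow 2)
    · refine Eventually.of_forall fun t => Eventually.of_forall fun x => ?_
      rw [norm_pow, norm_norm]
      gcongr
      exact hbound t x
    · simp_rw [mul_pow]
      exact ((Lp.memLp ξ).integrable_norm_pow (by norm_num)).const_mul _
    · filter_upwards [hv] with x hx
      have h1 : HasLineDerivAt ℝ h (fderiv ℝ h (v x) (ξ x)) (v x) (ξ x) :=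
        hx.hasFDerivAt.hasLineDerivAt _
      rw [HasLineDerivAt, hasDerivAt_iff_tendsto_slope_zero,
        tendsto_iff_norm_sub_tendsto_zero] at h1
      have h2 := h1.pow 2
      simpa using h2
  rw [integral_zero] at hlim
  have hsq : ∀ t : ℝ, ‖t⁻¹ • (hK.compLp h0 (v + (0 + t) • ξ) - hK.compLp h0 (v + (0 : ℝ) • ξ))
      - M ξ‖ = √(∫ x in Ω.carrier,
        ‖t⁻¹ • (h (v x + t • ξ x) - h (v x)) - fderiv ℝ h (v x) (ξ x)‖ ^ 2) := by
    intro t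
    rw [← Real.sqrt_sq (norm_nonneg (t⁻¹ • _ - M ξ)), norm_sq_L2vec]
    congr 1
    exact integral_congr_ae (by filter_upwards [hco t] with x hx; rw [hx])
  simp_rw [hsq]
  simpa using hlim.sqrt

/-- The chosen operator is itself a Gâteaux derivative, so no uniqueness is needed. -/
theorem HasGateauxDerivAt.gateauxDeriv {E F : Type*} [NormedAddCommGroup E] [NormedSpace ℝ E]
    [NormedAddCommGroup F] [NormedSpace ℝ F] {f : E → F} {M : E →L[ℝ] F} {v : E}
    (h : HasGateauxDerivAt f M v) : HasGateauxDerivAt f (gateauxDeriv f v) v := by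
  have hex : ∃ M : E →L[ℝ] F, HasGateauxDerivAt f M v := ⟨M, h⟩
  rw [ICL2TV.gateauxDeriv, dif_pos hex]
  exact hex.choose_spec

theorem hasGateauxDerivAt_gradTheta (hγ : 0 < γ) (ε : ℝ) (v : L2vec Ω)
    (hv : ∀ᵐ x ∂Ω.vol, ‖v x‖ ≠ γ) :
    HasGateauxDerivAt (gradTheta Ω hγ ε) (gateauxDeriv (gradTheta Ω hγ ε) v) v := by
  obtain ⟨M, hM⟩ := exists_hasGateauxDerivAt_compLp (lipschitzWith_huberGrad hγ) (huberGrad_zero γ)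
    v (by filter_upwards [hv] with x hx using differentiableAt_huberGrad hγ hx)
  have h : HasGateauxDerivAt (gradTheta Ω hγ ε) (M + ε • ContinuousLinearMap.id ℝ (L2vec Ω)) v := by
    intro ξ
    have h1 := hM ξ
    have h2 : HasLineDerivAt ℝ (fun v : L2vec Ω => ε • v) (ε • ξ) v ξ :=
      ((ε • ContinuousLinearMap.id ℝ (L2vec Ω)).hasFDerivAt (x := v)).hasLineDerivAt ξ
    exact HasDerivAt.add h1 h2
  exact h.gateauxDeriv

/-! ### Strong convexity, Lax–Milgram and differentiation of solution maps -/

section Abstract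

variable {X : Type*} [NormedAddCommGroup X] [NormedSpace ℝ X]

/-- `f` is strongly convex with modulus `m`, `D` being its derivative. -/
def StrongSupport (f : X → ℝ) (D : X → X →L[ℝ] ℝ) (m : ℝ) : Prop :=
  ∀ z δ, f z + D z δ + m * ‖δ‖ ^ 2 ≤ f (z + δ)

namespace StrongSupport

variable {f : X → ℝ} {D : X → X →L[ℝ] ℝ} {m : ℝ}

/-- Apply the support inequality at the midpoint in the directions of `a` and of `b`; the linear
terms cancel. -/
theorem midpoint_le (h : StrongSupport f D m) (a b : X) :
    2 * f ((1 / 2 : ℝ) • (a + b)) + m / 2 * ‖a - b‖ ^ 2 ≤ f a + f b := by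
  have h1 := h ((1 / 2 : ℝ) • (a + b)) ((1 / 2 : ℝ) • (a - b))
  have h2 := h ((1 / 2 : ℝ) • (a + b)) (-((1 / 2 : ℝ) • (a - b)))
  have e1 : (1 / 2 : ℝ) • (a + b) + (1 / 2 : ℝ) • (a - b) = a := by module
  have e2 : (1 / 2 : ℝ) • (a + b) + -((1 / 2 : ℝ) • (a - b)) = b := by module
  have e3 : ‖(1 / 2 : ℝ) • (a - b)‖ = 1 / 2 * ‖a - b‖ := by
    rw [norm_smul, Real.norm_of_nonneg (by norm_num)]
  rw [e1, e3] at h1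
  rw [e2, norm_neg, e3, map_neg] at h2
  nlinarith

/-- By the midpoint inequality, points whose values are within `η` of the infimum are within `√(4 /
m * η)` of each other. So a minimising sequence is Cauchy, and minimisers coincide. -/
theorem exists_isMinOn_iff [CompleteSpace X] (h : StrongSupport f D m) (hm : 0 < m)
    (hf : Continuous f) (hbdd : BddBelow (range f)) :
    ∃ z₀, ∀ z, IsMinOn f univ z ↔ z = z₀ := by
  have hinf : ∀ x, (⨅ x, f x) ≤ f x := fun x => ciInf_le hbdd x
  set i := ⨅ x, f x
  have hex : ∀ n : ℕ, ∃ x, f x < i + 1 / (n + 1) := fun n =>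
    exists_lt_of_ciInf_lt (lt_add_of_pos_right i Nat.one_div_pos_of_nat)
  choose x hx using hex
  have hdist : ∀ a b : X, ∀ η : ℝ, f a ≤ i + η → f b ≤ i + η → ‖a - b‖ ^ 2 ≤ 4 / m * η := by
    intro a b η ha hb
    have h1 := h.midpoint_le a b
    have h2 := hinf ((1 / 2 : ℝ) • (a + b))
    have h3 : m * ‖a - b‖ ^ 2 ≤ 4 * η := by linarith
    calc ‖a - b‖ ^ 2 = m⁻¹ * (m * ‖a - b‖ ^ 2) := by field_simp
      _ ≤ m⁻¹ * (4 * η) := by gcongr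
      _ = _ := by ring
  have hlim : Tendsto (fun n : ℕ => √(4 / m * (1 / ((n : ℝ) + 1)))) atTop (𝓝 0) := by
    have h1 := (tendsto_one_div_add_atTop_nhds_zero_nat (𝕜 := ℝ)).const_mul (4 / m)
    simpa using h1.sqrt
  have hc : CauchySeq x := by
    refine cauchySeq_of_le_tendsto_0 _ (fun n k N hn hk => ?_) hlim
    rw [dist_eq_norm]
    refine Real.le_sqrt_of_sq_le (hdist _ _ _ ?_ ?_)
    · exact (hx n).le.trans (by gcongr)
    · exact (hx k).le.trans (by gcongr)
  obtain ⟨z₀, hz₀⟩ := cauchySeq_tendsto_of_complete hc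
  have hmin : f z₀ ≤ i := by
    have h1 : Tendsto (fun n => f (x n)) atTop (𝓝 (f z₀)) := (hf.tendsto z₀).comp hz₀
    have h2 : Tendsto (fun n : ℕ => i + 1 / ((n : ℝ) + 1)) atTop (𝓝 (i + 0)) :=
      tendsto_one_div_add_atTop_nhds_zero_nat.const_add i
    rw [add_zero] at h2
    exact le_of_tendsto_of_tendsto' h1 h2 fun n => (hx n).le
  refine ⟨z₀, fun z => ⟨fun hz => ?_, ?_⟩⟩
  · have h1 : f z ≤ i := le_ciInf fun y => isMinOn_iff.1 hz y (mem_univ y)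
    have h2 := hdist z z₀ 0 (by linarith) (by linarith)
    rw [mul_zero] at h2
    have h3 : ‖z - z₀‖ = 0 := by
      have := sq_nonneg ‖z - z₀‖
      exact pow_eq_zero_iff two_ne_zero |>.1 (le_antisymm h2 this)
    exact sub_eq_zero.1 (norm_eq_zero.1 h3)
  · rintro rfl
    exact isMinOn_iff.2 fun y _ => hmin.trans (hinf y)

/-- The distance to the minimiser is controlled by the size of the derivative. -/
theorem norm_sub_le_of_isMinOn (h : StrongSupport f D m) {z : X} (hz : IsMinOn f univ z) (y : X) :
    m * ‖z - y‖ ≤ ‖D y‖ := by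
  have h1 := h y (z - y)
  rw [add_sub_cancel] at h1
  have h2 : f z ≤ f y := isMinOn_iff.1 hz y (mem_univ y)
  have h3 : -(D y (z - y)) ≤ ‖D y‖ * ‖z - y‖ :=
    (neg_le_abs _).trans ((D y).le_opNorm (z - y))
  rcases (norm_nonneg (z - y)).eq_or_lt with h0 | h0
  · rw [← h0, mul_zero]; exact norm_nonneg _
  · refine le_of_mul_le_mul_right ?_ h0
    linarith

/-- Add the support inequalities at `z` and at `z + δ`. -/
theorem monotone (h : StrongSupport f D m) (z δ : X) :
    2 * m * ‖δ‖ ^ 2 ≤ (D (z + δ) - D z) δ := by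
  have h1 := h z δ
  have h2 := h (z + δ) (-δ)
  rw [add_neg_cancel_right, map_neg, norm_neg] at h2
  rw [_root_.sub_apply]
  linarith

/-- The quadratic form of `A` is a limit of difference quotients of `D`, to which strong
monotonicity applies. -/
theorem coercive_of_hasGateauxDerivAt (h : StrongSupport f D m) {z : X}
    {A : X →L[ℝ] X →L[ℝ] ℝ} (hA : HasGateauxDerivAt D A z) (δ : X) :
    2 * m * ‖δ‖ ^ 2 ≤ A δ δ := by
  have h1 := hA δ
  rw [HasLineDerivAt, hasDerivAt_iff_tendsto_slope_zero] at h1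
  have h2 := ((ContinuousLinearMap.apply ℝ ℝ δ).continuous.tendsto (A δ)).comp h1
  refine ge_of_tendsto h2 ?_
  filter_upwards [self_mem_nhdsWithin] with t ht
  have ht0 : t ≠ 0 := ht
  have h3 := h.monotone z (t • δ)
  rw [norm_smul, mul_pow, Real.norm_eq_abs, sq_abs, map_smul, smul_eq_mul] at h3
  simp only [Function.comp_apply, zero_add, zero_smul, add_zero,
    ContinuousLinearMap.apply_apply, _root_.smul_apply, smul_eq_mul]
  have ht2 : 0 < t ^ 2 := by positivity
  calc 2 * m * ‖δ‖ ^ 2 = (t ^ 2)⁻¹ * (2 * m * (t ^ 2 * ‖δ‖ ^ 2)) := by field_simp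
    _ ≤ (t ^ 2)⁻¹ * (t * (D (z + t • δ) - D z) δ) := by gcongr
    _ = _ := by field_simp

end StrongSupport

/-- Lax–Milgram on a space isomorphic to a Hilbert space. -/
theorem isInvertible_of_coercive {V : Type*} [NormedAddCommGroup V] [InnerProductSpace ℝ V]
    [CompleteSpace V] (e : V ≃L[ℝ] X) {A : X →L[ℝ] X →L[ℝ] ℝ} {c : ℝ} (hc : 0 < c)
    (hA : ∀ x, c * ‖x‖ ^ 2 ≤ A x x) : A.IsInvertible := by
  -- The form is pulled back to the Hilbert space `V`; coercivity survives up to the square of the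
  -- bound of `e.symm`.
  let B : V →L[ℝ] V →L[ℝ] ℝ := A.bilinearComp (e : V →L[ℝ] X) (e : V →L[ℝ] X)
  have hB : IsCoercive B := by
    obtain ⟨K, hK, hle⟩ := (e.symm : X →L[ℝ] V).bound
    refine ⟨c / K ^ 2, by positivity, fun v => ?_⟩
    have h1 := hle (e v)
    rw [ContinuousLinearEquiv.coe_coe, e.symm_apply_apply] at h1
    have h2 : ‖v‖ * ‖v‖ ≤ K ^ 2 * ‖e v‖ ^ 2 := by nlinarith [norm_nonneg v]
    calc c / K ^ 2 * ‖v‖ * ‖v‖ = c / K ^ 2 * (‖v‖ * ‖v‖) := by ring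
      _ ≤ c / K ^ 2 * (K ^ 2 * ‖e v‖ ^ 2) := by gcongr
      _ = c * ‖e v‖ ^ 2 := by field_simp
      _ ≤ _ := hA (e v)
  refine ⟨e.symm.trans (hB.continuousLinearEquivOfBilin.trans
    ((InnerProductSpace.toDual ℝ V).toContinuousLinearEquiv.trans
      (e.arrowCongr (ContinuousLinearEquiv.refl ℝ ℝ)))), ?_⟩
  ext x y
  simp [B, ContinuousLinearEquiv.arrowCongr]

variable {E : Type*} [NormedAddCommGroup E] [NormedSpace ℝ E]
variable {F : Type*} [NormedAddCommGroup F] [NormedSpace ℝ F]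

/-- Chain rule for an outer map which is Lipschitz and Gâteaux differentiable. -/
theorem HasGateauxDerivAt.comp_hasFDerivAt [FiniteDimensional ℝ E] {N : X → F} {K : NNReal}
    (hN : LipschitzWith K N) {a : E → X} {a' : E →L[ℝ] X} {e₀ : E} {M : X →L[ℝ] F}
    (hM : HasGateauxDerivAt N M (a e₀)) (ha : HasFDerivAt a a' e₀) :
    HasFDerivAt (fun e => N (a e)) (M ∘L a') e₀ := by
  have hlip : LipschitzWith (K * ‖a'‖₊) fun q : E => N (a e₀ + a' q) :=
    hN.comp ((LipschitzWith.of_dist_le_mul fun x y => by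
      rw [dist_add_left]; exact a'.lipschitz.dist_le_mul x y))
  have hf : HasFDerivAt (fun q : E => N (a e₀ + a' q)) (M ∘L a') 0 := by
    -- In finite dimensions, a Lipschitz map whose line derivatives are given by a linear map is
    -- Fréchet differentiable: the unit sphere is compact, so the convergence is uniform in the
    -- direction.
    refine hlip.hasFDerivAt_of_hasLineDerivAt_of_closure (s := univ) (by simp) fun v _ => ?_
    have := hM (a' v)
    simpa [HasLineDerivAt] using this
  rw [hasFDerivAt_iff_isLittleO_nhds_zero] at hf ha ⊢
  -- Replacing `a` by its linearisation costs at most `K` times its remainder.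
  have h1 : (fun h => N (a (e₀ + h)) - N (a e₀ + a' h)) =o[𝓝 0] fun h => h := by
    refine Asymptotics.IsBigO.trans_isLittleO (Asymptotics.IsBigO.of_bound K
      (Eventually.of_forall fun h => ?_)) ha
    refine (hN.norm_sub_le _ _).trans_eq ?_
    rw [sub_sub]
  refine (h1.add hf).congr_left fun h => ?_
  simp only [zero_add, map_zero, add_zero]
  abel

/-- Differentiability of a solution map from an error bound and consistency to first order. -/
theorem hasFDerivAt_of_error_bound {D : E → X → F} {R : E → X} {L : E →L[ℝ] X} {p : E} {c : ℝ}
    (hc : 0 < c) (hbound : ∀ᶠ q in 𝓝 p, ∀ y, c * ‖R q - y‖ ≤ ‖D q y‖) (h0 : D p (R p) = 0)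
    (hD : HasFDerivAt (fun q => D q (R p + L (q - p))) (0 : E →L[ℝ] F) p) :
    HasFDerivAt R L p := by
  rw [hasFDerivAt_iff_isLittleO] at hD ⊢
  refine Asymptotics.IsBigO.trans_isLittleO (Asymptotics.IsBigO.of_bound c⁻¹ ?_) hD
  filter_upwards [hbound] with q hq
  -- The error bound is used at the predicted solution.
  have h1 := hq (R p + L (q - p))
  rw [sub_self, map_zero, add_zero, h0, _root_.zero_apply, sub_zero, sub_zero,
    sub_sub, inv_mul_eq_div, le_div_iff₀ hc, mul_comm]
  exact h1

end Abstract

/-! ### The Sobolev space -/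

/-- Each test function and index imposes an equation between continuous functionals on `L² × L²`.
Closedness makes `H1` complete, as minimisation and Lax–Milgram require. -/
theorem isClosed_H1 (Ω : Domain) : IsClosed (H1 Ω : Set (WithLp 2 (L2 Ω × L2vec Ω))) := by
  have key : ∀ φ : E3 → ℝ, IsTest Ω.carrier φ → ∀ i : Fin 3,
      IsClosed {z : WithLp 2 (L2 Ω × L2vec Ω) |
        ∫ x in Ω.carrier, z.fst x * fderiv ℝ φ x (EuclideanSpace.single i 1)
          = - ∫ x in Ω.carrier, z.snd x i * φ x} := by
    intro φ hφ i
    have hd : MemLp (fun x => fderiv ℝ φ x (EuclideanSpace.single i 1)) 2 Ω.vol :=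
      Continuous.memLp_of_hasCompactSupport
        ((hφ.contDiff.continuous_fderiv (by simp)).clm_apply continuous_const)
        (hφ.compact.fderiv_apply ℝ _)
    have hs : MemLp (fun x => φ x • (EuclideanSpace.single i 1 : E3)) 2 Ω.vol :=
      (ContinuousLinearMap.toSpanSingleton ℝ (EuclideanSpace.single i 1 : E3)).comp_memLp'
        (hφ.memLp _)
    have e1 : ∀ u : L2 Ω, ∫ x in Ω.carrier, u x * fderiv ℝ φ x (EuclideanSpace.single i 1)
        = ⟪hd.toLp _, u⟫ := by
      intro u
      rw [L2.inner_def]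
      refine integral_congr_ae ?_
      filter_upwards [hd.coeFn_toLp] with x hx
      rw [hx]; simp
    have e2 : ∀ q : L2vec Ω, ∫ x in Ω.carrier, q x i * φ x = ⟪hs.toLp _, q⟫ := by
      intro q
      rw [L2.inner_def]
      refine integral_congr_ae ?_
      filter_upwards [hs.coeFn_toLp] with x hx
      rw [hx, real_inner_smul_left, EuclideanSpace.inner_single_left]
      simp [mul_comm]
    simp_rw [e1, e2]
    exact isClosed_eq
      (continuous_const.inner (WithLp.fstL 2 ℝ (L2 Ω) (L2vec Ω)).continuous)
      (continuous_const.inner (WithLp.sndL 2 ℝ (L2 Ω) (L2vec Ω)).continuous).neg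
  have e : (H1 Ω : Set (WithLp 2 (L2 Ω × L2vec Ω)))
      = ⋂ (φ : E3 → ℝ) (_ : IsTest Ω.carrier φ) (i : Fin 3),
        {z : WithLp 2 (L2 Ω × L2vec Ω) |
        ∫ x in Ω.carrier, z.fst x * fderiv ℝ φ x (EuclideanSpace.single i 1)
          = - ∫ x in Ω.carrier, z.snd x i * φ x} := by
    ext z
    simp only [mem_iInter]
    exact ⟨fun h φ hφ i => h φ hφ.contDiff hφ.compact hφ.supp i,
      fun h φ h1 h2 h3 i => h φ ⟨h1, h2, h3⟩ i⟩
  rw [e]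
  exact isClosed_iInter fun φ => isClosed_iInter fun hφ => isClosed_iInter fun i => key φ hφ i

instance : CompleteSpace (H1 Ω) := (isClosed_H1 Ω).completeSpace_coe

theorem norm_sq_H1 (u : H1 Ω) : ‖u‖ ^ 2 = ‖val Ω u‖ ^ 2 + ‖fullGrad Ω u‖ ^ 2 :=
  WithLp.prod_norm_sq_eq_of_L2 (u : WithLp 2 (L2 Ω × L2vec Ω))

theorem coeFn_gradSpace (u : H1 Ω) : gradSpace Ω u =ᵐ[Ω.vol] fun x =>
    Matrix.toEuclideanCLM (n := Fin 3) (𝕜 := ℝ) (Matrix.diagonal ![1, 1, 0]) (fullGrad Ω u x) :=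
  ContinuousLinearMap.coeFn_compLpL _ _

theorem coeFn_gradTime (u : H1 Ω) : gradTime Ω u =ᵐ[Ω.vol] fun x =>
    Matrix.toEuclideanCLM (n := Fin 3) (𝕜 := ℝ) (Matrix.diagonal ![0, 0, 1]) (fullGrad Ω u x) :=
  ContinuousLinearMap.coeFn_compLpL _ _

theorem gradSpace_add_gradTime (u : H1 Ω) : gradSpace Ω u + gradTime Ω u = fullGrad Ω u := by
  refine Lp.ext ?_
  filter_upwards [Lp.coeFn_add (gradSpace Ω u) (gradTime Ω u), coeFn_gradSpace u,
    coeFn_gradTime u] with x h1 h2 h3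
  rw [h1, Pi.add_apply, h2, h3]
  ext i
  fin_cases i <;> simp [Matrix.mulVec_diagonal]

theorem inner_gradSpace_gradTime (u : H1 Ω) : ⟪gradSpace Ω u, gradTime Ω u⟫ = 0 := by
  rw [L2.inner_def]
  refine integral_eq_zero_of_ae ?_
  filter_upwards [coeFn_gradSpace u, coeFn_gradTime u] with x h2 h3
  rw [h2, h3, PiLp.inner_apply]
  simp [Fin.sum_univ_three, Matrix.mulVec_diagonal]

theorem gradK_apply (κ : ℝ) (u : H1 Ω) :
    gradK Ω κ u = κ • gradSpace Ω u + (1 - κ) • gradTime Ω u := rfl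

theorem norm_sq_gradK (κ : ℝ) (u : H1 Ω) :
    ‖gradK Ω κ u‖ ^ 2 = κ ^ 2 * ‖gradSpace Ω u‖ ^ 2 + (1 - κ) ^ 2 * ‖gradTime Ω u‖ ^ 2 := by
  rw [gradK_apply, norm_add_sq_real, norm_smul, norm_smul, real_inner_smul_left,
    real_inner_smul_right, inner_gradSpace_gradTime, mul_pow, mul_pow, Real.norm_eq_abs,
    Real.norm_eq_abs, sq_abs, sq_abs]
  ring

theorem min_mul_norm_sq_fullGrad_le (κ : ℝ) (u : H1 Ω) :
    min (κ ^ 2) ((1 - κ) ^ 2) * ‖fullGrad Ω u‖ ^ 2 ≤ ‖gradK Ω κ u‖ ^ 2 := by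
  rw [norm_sq_gradK, ← gradSpace_add_gradTime, norm_add_sq_real, inner_gradSpace_gradTime,
    mul_zero, add_zero, mul_add]
  gcongr
  · exact min_le_left _ _
  · exact min_le_right _ _

theorem cFun_apply (u : H1 Ω) : cFun Ω u = ∫ x in Ω.carrier, val Ω u x := inner_chi _

/-- Coercivity of the quadratic part of the functional, uniformly in the parameters. -/
theorem exists_norm_sq_state_le (Ω : Domain) : ∃ C : ℝ, 0 < C ∧ ∀ δ : State Ω,
    ‖δ‖ ^ 2 ≤ C * (‖val Ω δ.1‖ ^ 2 + ‖fullGrad Ω (δ.1 - δ.2)‖ ^ 2 + ‖fullGrad Ω δ.2‖ ^ 2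
      + cFun Ω δ.2 ^ 2) := by
  obtain ⟨P, hP0, hP⟩ := exists_poincare Ω
  refine ⟨3 + 2 * P ^ 2, by positivity, fun δ => ?_⟩
  have h2 : ‖val Ω δ.2‖ ^ 2 ≤ 2 * P ^ 2 * (‖fullGrad Ω δ.2‖ ^ 2 + cFun Ω δ.2 ^ 2) := by
    have h := hP (val Ω δ.2) (fullGrad Ω δ.2) δ.2.2
    rw [← cFun_apply] at h
    calc ‖val Ω δ.2‖ ^ 2 ≤ (P * (‖fullGrad Ω δ.2‖ + |cFun Ω δ.2|)) ^ 2 := by gcongr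
      _ ≤ 2 * P ^ 2 * (‖fullGrad Ω δ.2‖ ^ 2 + |cFun Ω δ.2| ^ 2) := by
        nlinarith [sq_nonneg (P * (‖fullGrad Ω δ.2‖ - |cFun Ω δ.2|))]
      _ = _ := by rw [sq_abs]
  have h1 : ‖fullGrad Ω δ.1‖ ^ 2
      ≤ 2 * (‖fullGrad Ω (δ.1 - δ.2)‖ ^ 2 + ‖fullGrad Ω δ.2‖ ^ 2) := by
    have h : ‖fullGrad Ω δ.1‖ ≤ ‖fullGrad Ω (δ.1 - δ.2)‖ + ‖fullGrad Ω δ.2‖ := by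
      calc ‖fullGrad Ω δ.1‖ = ‖fullGrad Ω (δ.1 - δ.2) + fullGrad Ω δ.2‖ := by
            rw [← map_add, sub_add_cancel]
        _ ≤ _ := norm_add_le _ _
    calc ‖fullGrad Ω δ.1‖ ^ 2 ≤ (‖fullGrad Ω (δ.1 - δ.2)‖ + ‖fullGrad Ω δ.2‖) ^ 2 := by gcongr
      _ ≤ _ := by nlinarith [sq_nonneg (‖fullGrad Ω (δ.1 - δ.2)‖ - ‖fullGrad Ω δ.2‖)]
  -- The product carries the maximum norm, so each component is bounded separately.
  have hmax : ‖δ‖ = ‖δ.1‖ ∨ ‖δ‖ = ‖δ.2‖ := max_choice ‖δ.1‖ ‖δ.2‖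
  have hsum : ∀ {a b c d Q f v : ℝ}, 0 ≤ a → 0 ≤ b → 0 ≤ c → 0 ≤ d → 0 ≤ Q →
      v ≤ 2 * Q * (c + d) → f ≤ 2 * (b + c) →
      a + f ≤ (3 + 2 * Q) * (a + b + c + d) ∧ v + c ≤ (3 + 2 * Q) * (a + b + c + d) := by
    intro a b c d Q f v ha hb hc hd hQ hv hf
    have q1 := mul_nonneg hQ ha
    have q2 := mul_nonneg hQ hb
    have q3 := mul_nonneg hQ hc
    have q4 := mul_nonneg hQ hd
    constructor <;> linarith
  have := hsum (sq_nonneg ‖val Ω δ.1‖) (sq_nonneg ‖fullGrad Ω (δ.1 - δ.2)‖)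
    (sq_nonneg ‖fullGrad Ω δ.2‖) (sq_nonneg (cFun Ω δ.2)) (sq_nonneg P) h2 h1
  rw [← norm_sq_H1, ← norm_sq_H1] at this
  rcases hmax with h | h
  · rw [h]; exact this.1
  · rw [h]; exact this.2

/-! ### The functional `J` and its derivative -/

variable (g : L2 Ω) {ε : ℝ}

/-- The components of the derivative of `J` before the application of `Q*`. -/
noncomputable def components (hγ : 0 < γ) (ε : ℝ) (p : Param) (z : State Ω) :
    H1dual Ω × H1dual Ω :=
  (idOp Ω z.1 - dualAdj Ω (val Ω) g - p.1 • divK Ω p.2.2 (gradK Ω p.2.2 (z.1 - z.2)),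
    idOp Ω z.1 - dualAdj Ω (val Ω) g
      - p.2.1 • divK Ω (1 - p.2.2) (gradTheta Ω hγ ε (gradK Ω (1 - p.2.2) z.2))
      + cTensor Ω z.2)

theorem Qadj_apply (a b : H1dual Ω) (δ : State Ω) :
    Qadj Ω (a, b) δ = a (δ.1 - δ.2) + b δ.2 := by
  simp [Qadj, Q]

theorem dualAdj_apply {F : Type*} [NormedAddCommGroup F] [InnerProductSpace ℝ F]
    (G : H1 Ω →L[ℝ] F) (q : F) (u : H1 Ω) : dualAdj Ω G q u = ⟪q, G u⟫ := rfl

theorem divK_apply (κ : ℝ) (q : L2vec Ω) (u : H1 Ω) : divK Ω κ q u = -⟪q, gradK Ω κ u⟫ := rfl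

theorem idOp_apply (u v : H1 Ω) : idOp Ω u v = ⟪val Ω u, val Ω v⟫ := rfl

theorem cTensor_apply (u v : H1 Ω) : cTensor Ω u v = cFun Ω u * cFun Ω v := rfl

theorem Qadj_components_apply (hγ : 0 < γ) (p : Param) (z δ : State Ω) :
    Qadj Ω (components g hγ ε p z) δ = ⟪val Ω z.1 - g, val Ω δ.1⟫
      + p.1 * ⟪gradK Ω p.2.2 (z.1 - z.2), gradK Ω p.2.2 (δ.1 - δ.2)⟫
      + p.2.1 * ⟪gradTheta Ω hγ ε (gradK Ω (1 - p.2.2) z.2), gradK Ω (1 - p.2.2) δ.2⟫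
      + cFun Ω z.2 * cFun Ω δ.2 := by
  rw [components, Qadj_apply]
  simp only [_root_.sub_apply, _root_.add_apply,
    _root_.smul_apply, smul_eq_mul, idOp_apply, cTensor_apply, dualAdj_apply,
    divK_apply, map_sub,
    inner_sub_right, inner_sub_left]
  ring

theorem J_apply (p : Param) (z : State Ω) : J Ω g γ ε p z = 1 / 2 * ‖val Ω z.1 - g‖ ^ 2
    + p.1 / 2 * ‖gradK Ω p.2.2 (z.1 - z.2)‖ ^ 2
    + p.2.1 * Theta Ω γ ε (gradK Ω (1 - p.2.2) z.2) + 1 / 2 * cFun Ω z.2 ^ 2 := by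
  rw [cFun_apply]; rfl

theorem add_expansion {a₁ a₂ a₃ b₁ b₂ b₃ c₁ c₂ c₃ d₁ d₂ α β A B C D j j' s : ℝ}
    (hj' : j' = 1 / 2 * A + α / 2 * B + β * C + 1 / 2 * D ^ 2)
    (hA : A = a₁ ^ 2 + 2 * a₂ + a₃ ^ 2) (hB : B = b₁ ^ 2 + 2 * b₂ + b₃ ^ 2) (hC : C = c₂)
    (hD : D = d₁ + d₂)
    (hj : j = 1 / 2 * a₁ ^ 2 + α / 2 * b₁ ^ 2 + β * c₃ + 1 / 2 * d₁ ^ 2)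
    (hs : s = a₂ + α * b₂ + β * c₁ + d₁ * d₂) :
    j' = j + s + 1 / 2 * a₃ ^ 2 + α / 2 * b₃ ^ 2 + β * (c₂ - c₃ - c₁) + 1 / 2 * d₂ ^ 2 := by
  subst_vars; ring

/-- The expansion is exact: apart from the first-order term only squares and the remainder of `Θ`
are left. Strong convexity and differentiability of `J` are both read off from it. -/
theorem J_add (p : Param) (z δ : State Ω) (hγ : 0 < γ) :
    J Ω g γ ε p (z + δ) = J Ω g γ ε p z + Qadj Ω (components g hγ ε p z) δ
      + 1 / 2 * ‖val Ω δ.1‖ ^ 2 + p.1 / 2 * ‖gradK Ω p.2.2 (δ.1 - δ.2)‖ ^ 2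
      + p.2.1 * (Theta Ω γ ε (gradK Ω (1 - p.2.2) z.2 + gradK Ω (1 - p.2.2) δ.2)
          - Theta Ω γ ε (gradK Ω (1 - p.2.2) z.2)
          - ⟪gradTheta Ω hγ ε (gradK Ω (1 - p.2.2) z.2), gradK Ω (1 - p.2.2) δ.2⟫)
      + 1 / 2 * cFun Ω δ.2 ^ 2 := by
  have e1 : ‖val Ω (z + δ).1 - g‖ ^ 2
      = ‖val Ω z.1 - g‖ ^ 2 + 2 * ⟪val Ω z.1 - g, val Ω δ.1⟫ + ‖val Ω δ.1‖ ^ 2 := by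
    rw [← norm_add_sq_real, Prod.fst_add, map_add, add_sub_right_comm]
  have e2 : ‖gradK Ω p.2.2 ((z + δ).1 - (z + δ).2)‖ ^ 2
      = ‖gradK Ω p.2.2 (z.1 - z.2)‖ ^ 2
        + 2 * ⟪gradK Ω p.2.2 (z.1 - z.2), gradK Ω p.2.2 (δ.1 - δ.2)⟫
        + ‖gradK Ω p.2.2 (δ.1 - δ.2)‖ ^ 2 := by
    rw [← norm_add_sq_real, ← map_add, Prod.fst_add, Prod.snd_add, add_sub_add_comm]
  have e3 : gradK Ω (1 - p.2.2) (z + δ).2 = gradK Ω (1 - p.2.2) z.2 + gradK Ω (1 - p.2.2) δ.2 :=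
    map_add _ _ _
  have e4 : cFun Ω (z + δ).2 = cFun Ω z.2 + cFun Ω δ.2 := map_add _ _ _
  exact add_expansion (J_apply g p (z + δ)) e1 e2 (congrArg (Theta Ω γ ε) e3) e4 (J_apply g p z)
    (Qadj_components_apply g hγ p z δ)

theorem abs_remainder_le {a b c d A B C D n T α β γ ε j s : ℝ} (hγ : 0 < γ) (hε : 0 ≤ ε)
    (ha0 : 0 ≤ a) (hb0 : 0 ≤ b) (hc0 : 0 ≤ c) (ha : a ≤ A * n) (hb : b ≤ B * (2 * n))
    (hc : c ≤ C * n) (hd : |d| ≤ D * n) (hT0 : ε / 2 * c ^ 2 ≤ T)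
    (hT : T ≤ (1 / (2 * γ) + ε / 2) * c ^ 2) :
    |j + s + 1 / 2 * a ^ 2 + α / 2 * b ^ 2 + β * T + 1 / 2 * d ^ 2 - j - s|
      ≤ (1 / 2 * A ^ 2 + |α| / 2 * (B * 2) ^ 2 + |β| * ((1 / (2 * γ) + ε / 2) * C ^ 2)
        + 1 / 2 * D ^ 2) * n ^ 2 := by
  have hT' : |T| ≤ (1 / (2 * γ) + ε / 2) * (C * n) ^ 2 := by
    have t0 : 0 ≤ ε / 2 * c ^ 2 := by positivity
    rw [abs_of_nonneg (t0.trans hT0)]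
    exact hT.trans (by gcongr)
  calc _ = |1 / 2 * a ^ 2 + α / 2 * b ^ 2 + β * T + 1 / 2 * d ^ 2| := by congr 1; ring
    _ ≤ |1 / 2 * a ^ 2| + |α / 2 * b ^ 2| + |β * T| + |1 / 2 * d ^ 2| :=
        (abs_add_le _ _).trans (by gcongr; exact abs_add_three _ _ _)
    _ = 1 / 2 * a ^ 2 + |α| / 2 * b ^ 2 + |β| * |T| + 1 / 2 * |d| ^ 2 := by
        simp [abs_mul, abs_div]
    _ ≤ 1 / 2 * (A * n) ^ 2 + |α| / 2 * (B * (2 * n)) ^ 2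
          + |β| * ((1 / (2 * γ) + ε / 2) * (C * n) ^ 2) + 1 / 2 * (D * n) ^ 2 := by gcongr
    _ = _ := by ring

theorem hasFDerivAt_J (hγ : 0 < γ) (hε : 0 ≤ ε) (p : Param) (z : State Ω) :
    HasFDerivAt (J Ω g γ ε p) (Qadj Ω (components g hγ ε p z)) z := by
  rw [hasFDerivAt_iff_isLittleO_nhds_zero]
  have hO : (fun δ : State Ω => J Ω g γ ε p (z + δ) - J Ω g γ ε p z
      - Qadj Ω (components g hγ ε p z) δ) =O[𝓝 0] fun δ => ‖δ‖ ^ 2 := by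
    refine Asymptotics.IsBigO.of_bound (1 / 2 * ‖val Ω‖ ^ 2
      + |p.1| / 2 * (‖gradK Ω p.2.2‖ * 2) ^ 2
      + |p.2.1| * ((1 / (2 * γ) + ε / 2) * ‖gradK Ω (1 - p.2.2)‖ ^ 2)
      + 1 / 2 * ‖cFun Ω‖ ^ 2) (Eventually.of_forall fun δ => ?_)
    have hf : ‖δ.1‖ ≤ ‖δ‖ := norm_fst_le δ
    have hs : ‖δ.2‖ ≤ ‖δ‖ := norm_snd_le δ
    have b1 : ‖val Ω δ.1‖ ≤ ‖val Ω‖ * ‖δ‖ := (val Ω).le_opNorm_of_le hf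
    have b2 : ‖gradK Ω p.2.2 (δ.1 - δ.2)‖ ≤ ‖gradK Ω p.2.2‖ * (2 * ‖δ‖) :=
      (gradK Ω p.2.2).le_opNorm_of_le ((norm_sub_le _ _).trans (by linarith))
    have b3 : ‖gradK Ω (1 - p.2.2) δ.2‖ ≤ ‖gradK Ω (1 - p.2.2)‖ * ‖δ‖ :=
      (gradK Ω (1 - p.2.2)).le_opNorm_of_le hs
    have b4 : |cFun Ω δ.2| ≤ ‖cFun Ω‖ * ‖δ‖ := (cFun Ω).le_opNorm_of_le hs
    obtain ⟨t1, t2⟩ := Theta_add_sub hγ ε (gradK Ω (1 - p.2.2) z.2) (gradK Ω (1 - p.2.2) δ.2)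
    have hn : ‖‖δ‖ ^ 2‖ = ‖δ‖ ^ 2 := Real.norm_of_nonneg (sq_nonneg _)
    rw [hn]
    refine (congrArg (fun t => ‖t - J Ω g γ ε p z - Qadj Ω (components g hγ ε p z) δ‖)
      (J_add g p z δ hγ)).trans_le ?_
    exact abs_remainder_le hγ hε (norm_nonneg _) (norm_nonneg _) (norm_nonneg _) b1 b2 b3 b4 t1 t2
  exact hO.trans_isLittleO (Asymptotics.isLittleO_norm_pow_id one_lt_two)

theorem S_eq (hγ : 0 < γ) (hε : 0 ≤ ε) (p : Param) (z : State Ω) :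
    S Ω g γ ε p z = Qadj Ω (components g hγ ε p z) := (hasFDerivAt_J g hγ hε p z).fderiv

theorem J_nonneg (hγ : 0 < γ) (hε : 0 ≤ ε) {p : Param} (h1 : 0 < p.1) (h2 : 0 < p.2.1)
    (z : State Ω) : 0 ≤ J Ω g γ ε p z := by
  have := Theta_nonneg hγ hε (gradK Ω (1 - p.2.2) z.2)
  unfold J
  positivity

/-- Scalar form of strong convexity: `e` lies below the coefficient of each of the four terms of the
coercivity estimate, and `k` is the loss in passing from the full to the anisotropic gradient. -/
theorem modulus_mul_le {a b c d b' c' k e C n T α β ε j s : ℝ} (hα : 0 < α) (hβ : 0 < β)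
    (hC : 0 < C) (he : 0 ≤ e) (ha : 0 ≤ a) (hb : 0 ≤ b) (hc : 0 ≤ c) (hd : 0 ≤ d)
    (hε : 0 < ε) (he1 : e ≤ 1 / 2) (he2 : e ≤ α / 2 * k) (he3 : e ≤ β * (ε / 2) * k)
    (hn : n ≤ C * (a + b + c + d)) (hb' : k * b ≤ b') (hc' : k * c ≤ c')
    (hT : ε / 2 * c' ≤ T) :
    j + s + e / C * n ≤ j + s + 1 / 2 * a + α / 2 * b' + β * T + 1 / 2 * d := by
  have r1 : e * a ≤ 1 / 2 * a := by gcongr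
  have r2 : e * b ≤ α / 2 * b' := by
    calc _ ≤ α / 2 * k * b := by gcongr
      _ = α / 2 * (k * b) := by ring
      _ ≤ _ := by gcongr
  have r3 : e * c ≤ β * T := by
    calc _ ≤ β * (ε / 2) * k * c := by gcongr
      _ = β * (ε / 2 * (k * c)) := by ring
      _ ≤ β * (ε / 2 * c') := by gcongr
      _ ≤ _ := by gcongr
  have r4 : e * d ≤ 1 / 2 * d := by gcongr
  have key : e / C * n ≤ e * (a + b + c + d) := by
    rw [div_mul_eq_mul_div, div_le_iff₀ hC]
    calc _ ≤ _ := mul_le_mul_of_nonneg_left hn he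
      _ = _ := by ring
  linarith

/-- `J` is strongly convex, with a modulus depending continuously on the parameters. -/
theorem exists_strongSupport_J (hγ : 0 < γ) (hε : 0 < ε) :
    ∃ m : Param → ℝ, Continuous m ∧ ∀ p ∈ admissible,
      0 < m p ∧ StrongSupport (J Ω g γ ε p) (S Ω g γ ε p) (m p) := by
  obtain ⟨C, hC, h⟩ := exists_norm_sq_state_le Ω
  -- Smallest coefficient among the four quadratic terms; `min (κ ^ 2) ((1 - κ) ^ 2)` serves both
  -- `∇_κ` and `∇_{1-κ}` and is positive exactly because `κ ∉ {0, 1}`.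
  let η : Param → ℝ := fun p =>
    min (1 / 2) (min (p.1 / 2) (p.2.1 * (ε / 2)) * min (p.2.2 ^ 2) ((1 - p.2.2) ^ 2))
  refine ⟨fun p => η p / C, by fun_prop, fun p ⟨h1, h2, h3, h4⟩ => ?_⟩
  have hk : 0 < min (p.2.2 ^ 2) ((1 - p.2.2) ^ 2) :=
    lt_min (by positivity) (by have := sub_ne_zero.2 (Ne.symm h4); positivity)
  have hη : 0 < η p := lt_min (by norm_num) (mul_pos (lt_min (by positivity) (by positivity)) hk)
  refine ⟨by positivity, fun z δ => ?_⟩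
  rw [S_eq g hγ hε.le]
  refine le_of_le_of_eq ?_ (J_add g p z δ hγ).symm
  have t := (Theta_add_sub hγ ε (gradK Ω (1 - p.2.2) z.2) (gradK Ω (1 - p.2.2) δ.2)).1
  have k1 := min_mul_norm_sq_fullGrad_le p.2.2 (δ.1 - δ.2)
  have k2 := min_mul_norm_sq_fullGrad_le (1 - p.2.2) δ.2
  rw [sub_sub_cancel, min_comm] at k2
  have hη1 : η p ≤ 1 / 2 := min_le_left _ _
  have hη2 : η p ≤ p.1 / 2 * min (p.2.2 ^ 2) ((1 - p.2.2) ^ 2) :=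
    (min_le_right _ _).trans (by gcongr; exact min_le_left _ _)
  have hη3 : η p ≤ p.2.1 * (ε / 2) * min (p.2.2 ^ 2) ((1 - p.2.2) ^ 2) :=
    (min_le_right _ _).trans (by gcongr; exact min_le_right _ _)
  exact modulus_mul_le h1 h2 hC hη.le (sq_nonneg _) (sq_nonneg _) (sq_nonneg _) (sq_nonneg _) hε
    hη1 hη2 hη3 (h δ) k1 k2 t

/-! ### Chain rule for the optimality system -/

section Interpolation

variable {E X Y : Type*} [NormedAddCommGroup E] [NormedSpace ℝ E] [NormedAddCommGroup X]
  [NormedSpace ℝ X] [NormedAddCommGroup Y] [NormedSpace ℝ Y]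

theorem _root_.HasFDerivAt.continuousLinearMap_comp (A : X →L[ℝ] Y) {y : E → X} {y' : E →L[ℝ] X}
    {e₀ : E} (hy : HasFDerivAt y y' e₀) : HasFDerivAt (fun e => A (y e)) (A ∘L y') e₀ :=
  A.hasFDerivAt.comp e₀ hy

/-- Product rule for an operator depending affinely on a scalar; the difference `A - B` is the
source of the terms `∇ - ∂/∂t` and `div - ∂/∂t*` in `T1` and `T2`. -/
theorem hasFDerivAt_interpolation (A B : X →L[ℝ] Y) {k : E → ℝ} {k' : E →L[ℝ] ℝ} {y : E → X}
    {y' : E →L[ℝ] X} {e₀ : E} (hk : HasFDerivAt k k' e₀) (hy : HasFDerivAt y y' e₀) :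
    HasFDerivAt (fun e => (k e • A + (1 - k e) • B) (y e))
      ((k e₀ • A + (1 - k e₀) • B) ∘L y' + k'.smulRight ((A - B) (y e₀))) e₀ := by
  have hA : HasFDerivAt (fun e => A (y e)) (A ∘L y') e₀ := hy.continuousLinearMap_comp A
  have hB : HasFDerivAt (fun e => B (y e)) (B ∘L y') e₀ := hy.continuousLinearMap_comp B
  refine ((hk.smul hA).add ((hk.const_sub 1).smul hB)).congr_fderiv ?_
  ext v
  simp only [_root_.add_apply, _root_.smul_apply, _root_.sub_apply, _root_.neg_apply,
    ContinuousLinearMap.comp_apply, ContinuousLinearMap.smulRight_apply]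
  module

variable {U W D D' : Type*} [NormedAddCommGroup U] [NormedSpace ℝ U] [NormedAddCommGroup W]
  [NormedSpace ℝ W] [NormedAddCommGroup D] [NormedSpace ℝ D] [NormedAddCommGroup D']
  [NormedSpace ℝ D']

/-- The derivative of the optimality system, for arbitrary operators in place of the
differential operators and a Lipschitz, Gâteaux differentiable nonlinearity `N`. -/
theorem hasFDerivAt_optimality_system [FiniteDimensional ℝ E] (Gs Gt : U →L[ℝ] W)
    (Ds Dt : W →L[ℝ] D) (G : ℝ → U →L[ℝ] W) (hG : ∀ κ, G κ = κ • Gs + (1 - κ) • Gt)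
    (Dv : ℝ → W →L[ℝ] D) (hDv : ∀ κ, Dv κ = κ • Ds + (1 - κ) • Dt)
    (I T : U →L[ℝ] D) (d : D) (Qa : D × D →L[ℝ] D') {N : W → W} {K : NNReal}
    (hN : LipschitzWith K N) {M : W →L[ℝ] W} {P : E → ℝ × ℝ × ℝ} {P' : E →L[ℝ] ℝ × ℝ × ℝ}
    {Z : E → U × U} {Z' : E →L[ℝ] U × U} {e₀ : E} {α β κ : ℝ} {u w : U}
    (hP₀ : P e₀ = (α, β, κ)) (hZ₀ : Z e₀ = (u, w))
    (hM : HasGateauxDerivAt N M (G (1 - κ) w))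
    (hP : HasFDerivAt P P' e₀) (hZ : HasFDerivAt Z Z' e₀) :
    HasFDerivAt (fun e => Qa
      (I (Z e).1 - d - (P e).1 • Dv (P e).2.2 (G (P e).2.2 ((Z e).1 - (Z e).2)),
        I (Z e).1 - d - (P e).2.1 • Dv (1 - (P e).2.2) (N (G (1 - (P e).2.2) (Z e).2))
          + T (Z e).2))
      ((Qa ∘L (ContinuousLinearMap.toSpanSingleton ℝ (-Dv κ (G κ (u - w)), (0 : D))).coprod
          ((ContinuousLinearMap.toSpanSingleton ℝ
              ((0 : D), -Dv (1 - κ) (N (G (1 - κ) w)))).coprod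
            (ContinuousLinearMap.toSpanSingleton ℝ
              (-(α • (Ds - Dt) (G κ (u - w))) - α • Dv κ ((Gs - Gt) (u - w)),
                -(β • (Dt - Ds) (N (G (1 - κ) w)))
                  - β • Dv (1 - κ) (M ((Gt - Gs) w)))))) ∘L P'
        + (Qa ∘L ((I - α • (Dv κ ∘L G κ)).coprod I).prod
            (I.coprod (I - β • (Dv (1 - κ) ∘L M ∘L G (1 - κ)) + T))
          ∘L (ContinuousLinearMap.fst ℝ U U - ContinuousLinearMap.snd ℝ U U).prod
            (ContinuousLinearMap.snd ℝ U U)) ∘L Z') e₀ := by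
  have hα := hP.fst
  have hβ := hP.snd.fst
  have hκ := hP.snd.snd
  have hκ' := hκ.const_sub 1
  have hI := (hZ.fst.continuousLinearMap_comp I).sub_const d
  have hq := hasFDerivAt_interpolation Gs Gt hκ (hZ.fst.fun_sub hZ.snd)
  have hr := hasFDerivAt_interpolation Gs Gt hκ' hZ.snd
  simp_rw [← hG] at hq hr
  -- The only place where the nonlinearity is differentiated; finite dimensionality of `E` enters
  -- here.
  have hr' := HasGateauxDerivAt.comp_hasFDerivAt hN
    (a := fun e => G (1 - (P e).2.2) (Z e).2) (M := M) (by simpa only [hP₀, hZ₀] using hM) hr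
  have h1 := hI.fun_sub (hα.fun_smul (hasFDerivAt_interpolation Ds Dt hκ hq))
  have h2 := (hI.fun_sub (hβ.fun_smul (hasFDerivAt_interpolation Ds Dt hκ' hr'))).fun_add
    (hZ.snd.continuousLinearMap_comp T)
  have h3 := (h1.prodMk h2).continuousLinearMap_comp Qa
  simp only [← hDv] at h3
  refine h3.congr_fderiv ?_
  rw [hP₀, hZ₀]
  ext v
  obtain ⟨a, b, k, hv⟩ : ∃ a b k, P' v = (a, b, k) := ⟨_, _, _, rfl⟩
  obtain ⟨x, y, hw⟩ : ∃ x y, Z' v = (x, y) := ⟨_, _, rfl⟩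
  simp only [_root_.add_apply, ContinuousLinearMap.comp_apply]
  rw [← map_add]
  congr 1
  refine Prod.ext ?_ ?_
  · simp only [ContinuousLinearMap.prod_apply, ContinuousLinearMap.comp_apply,
      ContinuousLinearMap.coprod_apply, ContinuousLinearMap.toSpanSingleton_apply,
      ContinuousLinearMap.smulRight_apply, ContinuousLinearMap.coe_fst',
      ContinuousLinearMap.coe_snd', _root_.add_apply, _root_.sub_apply, _root_.smul_apply,
      _root_.neg_apply, Prod.fst_add, Prod.smul_fst, hv, hw, hDv, map_add, map_sub, map_smul]
    module
  · simp only [ContinuousLinearMap.prod_apply, ContinuousLinearMap.comp_apply,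
      ContinuousLinearMap.coprod_apply, ContinuousLinearMap.toSpanSingleton_apply,
      ContinuousLinearMap.smulRight_apply, ContinuousLinearMap.coe_fst',
      ContinuousLinearMap.coe_snd', _root_.add_apply, _root_.sub_apply, _root_.smul_apply,
      _root_.neg_apply, Prod.snd_add, Prod.smul_snd, hv, hw, hDv, map_add, map_sub, map_smul]
    module

/-- `hasFDerivAt_optimality_system` with values in dual spaces. -/
theorem hasFDerivAt_optimality_system_dual [FiniteDimensional ℝ E] (Gs Gt : U →L[ℝ] W)
    (Ds Dt : W →L[ℝ] (U →L[ℝ] ℝ)) (G : ℝ → U →L[ℝ] W) (hG : ∀ κ, G κ = κ • Gs + (1 - κ) • Gt)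
    (Dv : ℝ → W →L[ℝ] (U →L[ℝ] ℝ)) (hDv : ∀ κ, Dv κ = κ • Ds + (1 - κ) • Dt)
    (I T : U →L[ℝ] (U →L[ℝ] ℝ)) (d : (U →L[ℝ] ℝ)) (Qa : (U →L[ℝ] ℝ) × (U →L[ℝ] ℝ) →L[ℝ] (U × U →L[ℝ] ℝ)) {N : W → W} {K : NNReal}
    (hN : LipschitzWith K N) {M : W →L[ℝ] W} {P : E → ℝ × ℝ × ℝ} {P' : E →L[ℝ] ℝ × ℝ × ℝ}
    {Z : E → U × U} {Z' : E →L[ℝ] U × U} {e₀ : E} {α β κ : ℝ} {u w : U}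
    (hP₀ : P e₀ = (α, β, κ)) (hZ₀ : Z e₀ = (u, w))
    (hM : HasGateauxDerivAt N M (G (1 - κ) w))
    (hP : HasFDerivAt P P' e₀) (hZ : HasFDerivAt Z Z' e₀)
    {A : ℝ × ℝ × ℝ →L[ℝ] (U × U →L[ℝ] ℝ)} {B : U × U →L[ℝ] (U × U →L[ℝ] ℝ)}
    (hA : A = (Qa ∘L (ContinuousLinearMap.toSpanSingleton ℝ (-Dv κ (G κ (u - w)), (0 : (U →L[ℝ] ℝ)))).coprod
          ((ContinuousLinearMap.toSpanSingleton ℝ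
              ((0 : (U →L[ℝ] ℝ)), -Dv (1 - κ) (N (G (1 - κ) w)))).coprod
            (ContinuousLinearMap.toSpanSingleton ℝ
              (-(α • (Ds - Dt) (G κ (u - w))) - α • Dv κ ((Gs - Gt) (u - w)),
                -(β • (Dt - Ds) (N (G (1 - κ) w)))
                  - β • Dv (1 - κ) (M ((Gt - Gs) w)))))))
    (hB : B = (Qa ∘L ((I - α • (Dv κ ∘L G κ)).coprod I).prod
            (I.coprod (I - β • (Dv (1 - κ) ∘L M ∘L G (1 - κ)) + T))
          ∘L (ContinuousLinearMap.fst ℝ U U - ContinuousLinearMap.snd ℝ U U).prod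
            (ContinuousLinearMap.snd ℝ U U))) :
    HasFDerivAt (fun e => Qa
      (I (Z e).1 - d - (P e).1 • Dv (P e).2.2 (G (P e).2.2 ((Z e).1 - (Z e).2)),
        I (Z e).1 - d - (P e).2.1 • Dv (1 - (P e).2.2) (N (G (1 - (P e).2.2) (Z e).2))
          + T (Z e).2))
      (A ∘L P' + B ∘L Z') e₀ := by
  rw [hA, hB]
  exact hasFDerivAt_optimality_system Gs Gt Ds Dt G hG Dv hDv I T d Qa hN hP₀ hZ₀ hM hP hZ

end Interpolation

/-- Shows that the negative adjoint is affine in `κ` too, as the interpolation lemma requires. -/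
theorem divK_eq (κ : ℝ) : divK Ω κ = κ • divSpace Ω + (1 - κ) • divTime Ω := by
  ext q u
  have h : divK Ω κ q u = -⟪q, κ • gradSpace Ω u + (1 - κ) • gradTime Ω u⟫ := rfl
  have h1 : divSpace Ω q u = -⟪q, gradSpace Ω u⟫ := rfl
  have h2 : divTime Ω q u = -⟪q, gradTime Ω u⟫ := rfl
  rw [h]
  simp only [_root_.add_apply, _root_.smul_apply, h1, h2, smul_eq_mul, inner_add_right,
    real_inner_smul_right]
  ring

theorem Psi1_eq (hγ : 0 < γ) (hε : 0 ≤ ε) (κ : ℝ) (u : H1 Ω) :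
    Psi1 Ω γ ε κ u = gradTheta Ω hγ ε (gradK Ω κ u) := by
  rw [Psi1, gradient_Theta hγ hε]

theorem hasGateauxDerivAt_Psi2 (hγ : 0 < γ) (hε : 0 ≤ ε) {p : Param} {z : State Ω}
    (h : AvoidsKink Ω γ p z) : HasGateauxDerivAt (gradTheta Ω hγ ε)
      (Psi2 Ω γ ε (1 - p.2.2) z.2) (gradK Ω (1 - p.2.2) z.2) := by
  rw [Psi2, gradient_Theta hγ hε]
  exact hasGateauxDerivAt_gradTheta hγ ε _ h

theorem dSparam_eq {p : Param} {z : State Ω} {q : L2vec Ω}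
    (hq : Psi1 Ω γ ε (1 - p.2.2) z.2 = q) :
    dSparam Ω γ ε p z = Qadj Ω ∘L columns Ω
      (-divK Ω p.2.2 (gradK Ω p.2.2 (z.1 - z.2)), 0) (0, -divK Ω (1 - p.2.2) q)
      (-(p.1 • (divSpace Ω - divTime Ω) (gradK Ω p.2.2 (z.1 - z.2)))
          - p.1 • divK Ω p.2.2 ((gradSpace Ω - gradTime Ω) (z.1 - z.2)),
        -(p.2.1 • (divTime Ω - divSpace Ω) q)
          - p.2.1 • divK Ω (1 - p.2.2)
            (Psi2 Ω γ ε (1 - p.2.2) z.2 ((gradTime Ω - gradSpace Ω) z.2))) := by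
  subst hq; rfl

/-- The derivative of `S` along a pair of differentiable families of parameters and states. -/
theorem hasFDerivAt_S {E : Type*} [NormedAddCommGroup E] [NormedSpace ℝ E]
    [FiniteDimensional ℝ E] {e₀ : E} {P : E → Param} {P' : E →L[ℝ] Param} {Z : E → State Ω}
    {Z' : E →L[ℝ] State Ω} {p : Param} {z : State Ω} (hγ : 0 < γ) (hε : 0 ≤ ε)
    (hP₀ : P e₀ = p) (hZ₀ : Z e₀ = z) (hP : HasFDerivAt P P' e₀) (hZ : HasFDerivAt Z Z' e₀)
    (h : AvoidsKink Ω γ p z) :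
    HasFDerivAt (fun e => S Ω g γ ε (P e) (Z e))
      (dSparam Ω γ ε p z ∘L P' + dSstate Ω γ ε p z ∘L Z') e₀ := by
  obtain ⟨K, hK⟩ := lipschitzWith_gradTheta (Ω := Ω) hγ ε
  have key := hasFDerivAt_optimality_system_dual (U := H1 Ω) (W := L2vec Ω) (gradSpace Ω)
    (gradTime Ω) (divSpace Ω) (divTime Ω) (gradK Ω) (fun _ => rfl) (divK Ω) divK_eq (idOp Ω)
    (cTensor Ω) (dualAdj Ω (val Ω) g) (Qadj Ω) hK (P := P) (Z := Z) (e₀ := e₀)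
    (α := p.1) (β := p.2.1) (κ := p.2.2) (u := z.1) (w := z.2)
    (M := Psi2 Ω γ ε (1 - p.2.2) z.2) hP₀ hZ₀ (hasGateauxDerivAt_Psi2 hγ hε h) hP hZ
    (A := dSparam Ω γ ε p z) (B := dSstate Ω γ ε p z) (dSparam_eq (Psi1_eq hγ hε _ _)) rfl
  simp_rw [S_eq g hγ hε]
  exact key

/-! ### Derivatives of `S` and of the solution map -/

section Dual

variable {X Y : Type*} [NormedAddCommGroup X] [NormedSpace ℝ X] [NormedAddCommGroup Y]
  [NormedSpace ℝ Y] {A : X →L[ℝ] (X →L[ℝ] ℝ)} {B : Y →L[ℝ] (X →L[ℝ] ℝ)}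

theorem hasDerivAt_of_hasFDerivAt_toSpanSingleton {f : ℝ → X →L[ℝ] ℝ} {t : ℝ} {ξ : X}
    (h : HasFDerivAt f (B ∘L (0 : ℝ →L[ℝ] Y) + A ∘L ContinuousLinearMap.toSpanSingleton ℝ ξ) t) :
    HasDerivAt f (A ξ) t := by
  refine h.hasDerivAt.congr_deriv ?_
  rw [_root_.add_apply, ContinuousLinearMap.comp_apply, ContinuousLinearMap.comp_apply,
    _root_.zero_apply, map_zero, zero_add, ContinuousLinearMap.toSpanSingleton_apply, one_smul]

theorem hasFDerivAt_of_comp_id_add_comp_zero {f : Y → X →L[ℝ] ℝ} {p : Y}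
    (h : HasFDerivAt f (B ∘L ContinuousLinearMap.id ℝ Y + A ∘L (0 : Y →L[ℝ] X)) p) :
    HasFDerivAt f B p := by
  refine h.congr_fderiv (ContinuousLinearMap.ext fun v => ?_)
  change B v + A 0 = B v
  rw [map_zero, add_zero]

/-- The derivative of the solution of a parametrised equation `D q x = 0`. -/
theorem hasFDerivAt_solution {D : Y → X → X →L[ℝ] ℝ} {R : Y → X} {p : Y} {c : ℝ} (hc : 0 < c)
    (hbound : ∀ᶠ q in 𝓝 p, ∀ y, c * ‖R q - y‖ ≤ ‖D q y‖) (h0 : D p (R p) = 0)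
    (hA : A.IsInvertible)
    (hD : ∀ L : Y →L[ℝ] X, HasFDerivAt (fun q => D q (R p + L (q - p)))
      (B ∘L ContinuousLinearMap.id ℝ Y + A ∘L L) p) :
    HasFDerivAt R (-(A.inverse ∘L B)) p := by
  refine hasFDerivAt_of_error_bound hc hbound h0 ((hD _).congr_fderiv
    (ContinuousLinearMap.ext fun v => ?_))
  -- The choice of `L` cancels the first-order term, which is the consistency that the error bound
  -- needs.
  change B v + A (-(A.inverse (B v))) = 0
  have h := DFunLike.congr_fun hA.self_comp_inverse (B v)
  rw [ContinuousLinearMap.comp_apply, ContinuousLinearMap.id_apply] at h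
  rw [map_neg, h, add_neg_cancel]

end Dual

theorem hasGateauxDerivAt_S (hγ : 0 < γ) (hε : 0 ≤ ε) {p : Param} {z : State Ω}
    (hz : AvoidsKink Ω γ p z) : HasGateauxDerivAt (S Ω g γ ε p) (dSstate Ω γ ε p z) z := by
  intro ξ
  have hZ : HasFDerivAt (fun t : ℝ => z + t • ξ) (ContinuousLinearMap.toSpanSingleton ℝ ξ) 0 :=
    ((ContinuousLinearMap.toSpanSingleton ℝ ξ).hasFDerivAt (x := (0 : ℝ))).const_add z
  have hZ₀ : z + (0 : ℝ) • ξ = z := by rw [zero_smul, add_zero]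
  exact hasDerivAt_of_hasFDerivAt_toSpanSingleton
    (hasFDerivAt_S (E := ℝ) g hγ hε rfl hZ₀ (hasFDerivAt_const p (0 : ℝ)) hZ hz)

theorem hasFDerivAt_S_param (hγ : 0 < γ) (hε : 0 ≤ ε) {p : Param} {z : State Ω}
    (hz : AvoidsKink Ω γ p z) :
    HasFDerivAt (fun q => S Ω g γ ε q z) (dSparam Ω γ ε p z) p :=
  hasFDerivAt_of_comp_id_add_comp_zero (hasFDerivAt_S (E := Param) g hγ hε rfl rfl
    (hasFDerivAt_id p) (hasFDerivAt_const z p) hz)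

/-- Strong convexity and `0 ≤ J` give a unique minimiser, which `Classical.epsilon` must then
select. -/
theorem isMinOn_iff_eq_Rhat (hγ : 0 < γ) (hε : 0 < ε) {p : Param} (hp : p ∈ admissible)
    (z : State Ω) : IsMinOn (J Ω g γ ε p) univ z ↔ z = Rhat Ω g γ ε p := by
  obtain ⟨m, -, hconv⟩ := exists_strongSupport_J (Ω := Ω) g hγ hε
  have hcont : Continuous (J Ω g γ ε p) := continuous_iff_continuousAt.2 fun z =>
    (hasFDerivAt_J g hγ hε.le p z).continuousAt
  obtain ⟨z₀, hz₀⟩ := (hconv p hp).2.exists_isMinOn_iff (hconv p hp).1 hcont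
    ⟨0, by rintro _ ⟨z, rfl⟩; exact J_nonneg g hγ hε.le hp.1 hp.2.1 z⟩
  have h1 : IsMinOn (J Ω g γ ε p) univ (Rhat Ω g γ ε p) :=
    Classical.epsilon_spec (p := fun z => IsMinOn (J Ω g γ ε p) univ z) ⟨z₀, (hz₀ z₀).2 rfl⟩
  exact (hz₀ z).trans (by rw [(hz₀ _).1 h1])

theorem isInvertible_dSstate (hγ : 0 < γ) (hε : 0 < ε) {p : Param} (hp : p ∈ admissible)
    {z : State Ω} (hz : AvoidsKink Ω γ p z) : (dSstate Ω γ ε p z).IsInvertible := by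
  -- The operator does not depend on the datum, so `g = 0` may be taken.
  obtain ⟨m, -, hconv⟩ := exists_strongSupport_J (Ω := Ω) 0 hγ hε
  exact isInvertible_of_coercive (V := WithLp 2 (H1 Ω × H1 Ω))
    (WithLp.prodContinuousLinearEquiv 2 ℝ (H1 Ω) (H1 Ω)) (mul_pos two_pos (hconv p hp).1)
    fun δ => (hconv p hp).2.coercive_of_hasGateauxDerivAt (hasGateauxDerivAt_S 0 hγ hε.le hz) δ

theorem isOpen_admissible : IsOpen admissible :=
  (isOpen_lt continuous_const continuous_fst).inter
    ((isOpen_lt continuous_const (continuous_fst.comp continuous_snd)).inter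
      ((isOpen_ne.preimage (continuous_snd.comp continuous_snd)).inter
        (isOpen_ne.preimage (continuous_snd.comp continuous_snd))))

theorem hasFDerivAt_Rhat (hγ : 0 < γ) (hε : 0 < ε) {p : Param} (hp : p ∈ admissible)
    (hz : AvoidsKink Ω γ p (Rhat Ω g γ ε p)) :
    HasFDerivAt (Rhat Ω g γ ε) (-((dSstate Ω γ ε p (Rhat Ω g γ ε p)).inverse ∘L
      dSparam Ω γ ε p (Rhat Ω g γ ε p))) p := by
  obtain ⟨m, hm, hconv⟩ := exists_strongSupport_J (Ω := Ω) g hγ hε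
  have hmp := (hconv p hp).1
  -- By continuity `m q > m p / 2` near `p`, so a single constant serves for all nearby parameters.
  have hbound : ∀ᶠ q in 𝓝 p, ∀ y, m p / 2 * ‖Rhat Ω g γ ε q - y‖ ≤ ‖S Ω g γ ε q y‖ := by
    filter_upwards [isOpen_admissible.mem_nhds hp,
      hm.continuousAt.eventually_const_lt (half_lt_self hmp)] with q hq hmq y
    exact (mul_le_mul_of_nonneg_right hmq.le (norm_nonneg _)).trans
      ((hconv q hq).2.norm_sub_le_of_isMinOn ((isMinOn_iff_eq_Rhat g hγ hε hq _).2 rfl) y)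
  have hS0 : S Ω g γ ε p (Rhat Ω g γ ε p) = 0 :=
    (((isMinOn_iff_eq_Rhat g hγ hε hp _).2 rfl).isLocalMin univ_mem).fderiv_eq_zero
  refine hasFDerivAt_solution (half_pos hmp) hbound hS0 (isInvertible_dSstate hγ hε hp hz)
    fun L => ?_
  have hZ : HasFDerivAt (fun q : Param => Rhat Ω g γ ε p + L (q - p)) L p :=
    (((hasFDerivAt_id p).sub_const p).continuousLinearMap_comp L).const_add _
  have hZ₀ : Rhat Ω g γ ε p + L (p - p) = Rhat Ω g γ ε p := by
    rw [sub_self, map_zero, add_zero]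
  exact hasFDerivAt_S (E := Param) g hγ hε.le rfl hZ₀ (hasFDerivAt_id p) hZ hz

end ICL2TV

theorem mainTheorem3 (Ω : ICL2TV.Domain) (g : ICL2TV.L2 Ω) (γ ε : ℝ) (hγ : 0 < γ) (hε : 0 < ε) :
    -- the lower-level problem has exactly one minimiser, the value of the solution map
    (∀ p ∈ ICL2TV.admissible, ∀ z : ICL2TV.State Ω,
      IsMinOn (ICL2TV.J Ω g γ ε p) Set.univ z ↔ z = ICL2TV.Rhat Ω g γ ε p) ∧
    -- `Θ` and `J` are Fréchet differentiable, so that `∇Θ` and `S = ∇_{(u,w)} J` are meaningful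
    Differentiable ℝ (ICL2TV.Theta Ω γ ε) ∧
    (∀ p : ICL2TV.Param, Differentiable ℝ (ICL2TV.J Ω g γ ε p)) ∧
    -- the partial derivatives of `S`
    (∀ p ∈ ICL2TV.admissible, ∀ z : ICL2TV.State Ω, ICL2TV.AvoidsKink Ω γ p z →
      ICL2TV.HasGateauxDerivAt (gradient (ICL2TV.Theta Ω γ ε))
        (ICL2TV.Psi2 Ω γ ε (1 - p.2.2) z.2) (ICL2TV.gradK Ω (1 - p.2.2) z.2) ∧
      ICL2TV.HasGateauxDerivAt (ICL2TV.S Ω g γ ε p) (ICL2TV.dSstate Ω γ ε p z) z ∧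
      HasFDerivAt (fun q => ICL2TV.S Ω g γ ε q z) (ICL2TV.dSparam Ω γ ε p z) p ∧
      (ICL2TV.dSstate Ω γ ε p z).IsInvertible) ∧
    -- the derivative of the solution map
    (∀ p ∈ ICL2TV.admissible, ICL2TV.AvoidsKink Ω γ p (ICL2TV.Rhat Ω g γ ε p) →
      HasFDerivAt (ICL2TV.R Ω g γ ε)
        (-(ContinuousLinearMap.fst ℝ (ICL2TV.H1 Ω) (ICL2TV.H1 Ω) ∘L
            (ICL2TV.dSstate Ω γ ε p (ICL2TV.Rhat Ω g γ ε p)).inverse ∘L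
            ICL2TV.dSparam Ω γ ε p (ICL2TV.Rhat Ω g γ ε p)))
        p) := by
  refine ⟨fun p hp z => ICL2TV.isMinOn_iff_eq_Rhat g hγ hε hp z,
    fun v => (ICL2TV.hasGradientAt_Theta hγ hε.le v).differentiableAt,
    fun p z => (ICL2TV.hasFDerivAt_J g hγ hε.le p z).differentiableAt,
    fun p hp z hz => ⟨?_, ICL2TV.hasGateauxDerivAt_S g hγ hε.le hz,
      ICL2TV.hasFDerivAt_S_param g hγ hε.le hz, ICL2TV.isInvertible_dSstate hγ hε hp hz⟩,
    fun p hp hz => ?_⟩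
  · rw [ICL2TV.gradient_Theta hγ hε.le]
    exact ICL2TV.hasGateauxDerivAt_Psi2 hγ hε.le hz
  · refine (ICL2TV.hasFDerivAt_Rhat g hγ hε hp hz).fst.congr_fderiv ?_
    rw [ContinuousLinearMap.comp_neg]
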